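/- Let $R$ be a commutative Noetherian ring of finite global (homological) dimension; "sheaf" means sheaf of $R$-modules. Let $X$ be a topological space of finite homological dimension, i.e. there is an $n$ with $H^i(X,\mathcal F)=0$ for all $i>n$ and all sheaves $\mathcal F$ on $X$. A *stratification* of $X$ is a finite partition $\mathcal S$ of $X$ into non-empty locally closed subsets (strata), each of which is a simply connected topological manifold, such that the closure of every stratum is a union of strata. The *star* of $S\in\mathcal S$ is the open set $\mathrm{Et}_S=\bigcup_{T\in\mathcal S,\,S\subset\overline T}T$. A sheaf is *weakly constructible* if its restriction to every stratum is a constant sheaf, and *constructible* if moreover all its stalks are finitely generated. $\mathcal S$ is *acyclic* if for every weakly constructible sheaf $\mathcal F$ and every $S\in\mathcal S$ the natural map $\Gamma(\mathrm{Et}_S,\mathcal F)\to\mathcal F_x$ is an isomorphism for all $x\in S$, and $H^i(\mathrm{Et}_S,\mathcal F)=0$ for all $i>0$. For $*=+,b$ let $D^*_{w,c}(X)$ (respectively $D^*_c(X)$) be the full subcategory of $D^*(X)$, the bounded below (respectively bounded) derived category of sheaves on $X$, of those complexes all of whose cohomology sheaves are weakly constructible (respectively constructible). Let $Q_{\mathcal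 S}$ be the quiver whose vertices are the strata, with exactly one arrow $S\to T$ if $S\subset\overline T$ and none otherwise, and let $\rho_{\mathcal S}$ be the set of relations that identify any two paths (including paths of length $0$) with the same source and the same target. Let $\operatorname{Rep}(Q_{\mathcal S},\rho_{\mathcal S})$ be the category of representations of $Q_{\mathcal S}$ in $R$-modules that satisfy these relations, and $\operatorname{Rep_f}(Q_{\mathcal S},\rho_{\mathcal S})$ its full subcategory of representations with finitely generated stalks. Let $\Phi$ be the functor from sheaves on $X$ to $\operatorname{Rep}(Q_{\mathcal S},\rho_{\mathcal S})$ that sends $\mathcal F$ to $(\Gamma(\mathrm{Et}_S,\mathcal F))_{S\in\mathcal S}$ with the restriction maps, and $R\Phi: D^+(X)\to D^+(\operatorname{Rep}(Q_{\mathcal S},\rho_{\mathcal S}))$ its right derived functor. **Theorem.** Suppose that $\mathcal S$ is an acyclic stratification of $X$. Then the restriction of $R\Phi$ is an equivalence $$D^+_{w,c}(X)\xrightarrow{\ \sim\ }D^+(\operatorname{Rep}(Q_{\mathcal S},\rho_{\mathcal S})),$$ and it induces equivalences $$D^b_{w,c}(X)\xrightarrow{\ \sim\ }D^b(\operatorname{Rep}(Q_{\mathcal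 S},\rho_{\mathcal S})),\qquad D^b_c(X)\xrightarrow{\ \sim\ }D^b(\operatorname{Rep_f}(Q_{\mathcal S},\rho_{\mathcal S})),$$ the last one in the sense that its composite with the functor to $D(\operatorname{Rep}(Q_{\mathcal S},\rho_{\mathcal S}))$ induced by the exact inclusion $\operatorname{Rep_f}(Q_{\mathcal S},\rho_{\mathcal S})\subset\operatorname{Rep}(Q_{\mathcal S},\rho_{\mathcal S})$ is isomorphic to the restriction of $R\Phi$. -/

import Mathlib

open CategoryTheory CategoryTheory.Limits TopologicalSpace Opposite

universe u w₁ w₂ w₃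

noncomputable section

/-! ### Representations of quivers with relations -/

namespace QuiverRep

/-- A relation in a quiver `Q`: an `R`-linear combination of paths with the same source and the
same target. (The morphisms of `Paths Q` are the paths in `Q`, including those of length `0`.) -/
structure Relation (R : Type u) [CommRing R] (Q : Type u) [Quiver.{0} Q] where
  /-- the common source of the paths -/
  src : Paths Q
  /-- the common target of the paths -/
  tgt : Paths Q
  /-- the coefficients of the paths -/
  coeff : (src ⟶ tgt) →₀ R

/-- The category `Rep Q` of representations of `Q` in `R`-modules. A representation (a module for
each vertex and a linear map for each arrow) is the same as a functor on the category of paths, and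
maps of representations are natural transformations. -/
abbrev Rep (R : Type u) [CommRing R] (Q : Type u) [Quiver.{0} Q] :=
  Paths Q ⥤ ModuleCat.{u} R

variable {R : Type u} [CommRing R] {Q : Type u} [Quiver.{0} Q]

/-- The linear map by which the linear combination of paths `r` acts on the representation `V`. -/
def actRelation (V : Rep R Q) (r : Relation R Q) : V.obj r.src ⟶ V.obj r.tgt :=
  r.coeff.sum fun p c ↦ c • V.map p

/-- The representations that are compatible with all the relations in `ρ`. -/
def satisfies (ρ : Set (Relation R Q)) : ObjectProperty (Rep R Q) :=
  fun V ↦ ∀ r ∈ ρ, actRelation V r = 0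

/-- The category `Rep(Q, ρ)`, a full subcategory of `Rep Q`. -/
abbrev RepRel (ρ : Set (Relation R Q)) := (satisfies ρ).FullSubcategory

/-- The representations in `Rep(Q, ρ)` all of whose stalks are finitely generated. -/
def finiteStalks (ρ : Set (Relation R Q)) : ObjectProperty (RepRel ρ) :=
  fun V ↦ ∀ x : Paths Q, Module.Finite R (V.obj.obj x)

/-- The category `Rep_f(Q, ρ)`, a full subcategory of `Rep(Q, ρ)`. -/
abbrev RepRelFin (ρ : Set (Relation R Q)) := (finiteStalks ρ).FullSubcategory

/-! The categories `Rep(Q, ρ)` and, for Noetherian `R`, `Rep_f(Q, ρ)` are abelian. -/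

lemma actRelation_naturality {V W : Rep R Q} (f : V ⟶ W) (r : Relation R Q) :
    actRelation V r ≫ f.app _ = f.app _ ≫ actRelation W r := by
  simp only [actRelation, Finsupp.sum, Preadditive.sum_comp, Preadditive.comp_sum,
    Linear.smul_comp, Linear.comp_smul, f.naturality]

instance (ρ : Set (Relation R Q)) : (satisfies ρ).IsClosedUnderSubobjects where
  prop_of_mono {V W} f _ hW r hr := by
    rw [← cancel_mono (f.app r.tgt), actRelation_naturality, hW r hr]
    simp

instance (ρ : Set (Relation R Q)) : (satisfies ρ).IsClosedUnderQuotients where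
  prop_of_epi {V W} f _ hV r hr := by
    rw [← cancel_epi (f.app r.src), ← actRelation_naturality, hV r hr]
    simp

instance (ρ : Set (Relation R Q)) : (satisfies ρ).ContainsZero where
  exists_zero := by
    obtain ⟨Z, hZ⟩ := HasZeroObject.zero (C := Rep R Q)
    exact ⟨Z, hZ, fun r _ ↦ (((evaluation _ _).obj r.src).map_isZero hZ).eq_of_src _ _⟩

instance (ρ : Set (Relation R Q)) : (satisfies ρ).IsClosedUnderFiniteProducts where
  isClosedUnderLimitsOfShape J _ :=
    { limitsOfShape_le := by
        rintro V ⟨h⟩ r hr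
        refine (isLimitOfPreserves ((evaluation _ _).obj r.tgt) h.isLimit).hom_ext fun j ↦ ?_
        have := actRelation_naturality (h.π.app j) r
        rw [h.prop_diag_obj j r hr] at this
        simpa using this }

instance (ρ : Set (Relation R Q)) : Abelian (RepRel ρ) := inferInstance

/-- The functor that takes the stalk at the vertex `x`. -/
abbrev stalk (ρ : Set (Relation R Q)) (x : Paths Q) : RepRel ρ ⥤ ModuleCat.{u} R :=
  (satisfies ρ).ι ⋙ (evaluation _ _).obj x

instance (ρ : Set (Relation R Q)) : (satisfies ρ).ι.PreservesMonomorphisms :=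
  (satisfies ρ).preservesMonomorphisms_ι_of_isNormalEpiCategory

instance (ρ : Set (Relation R Q)) : (satisfies ρ).ι.PreservesEpimorphisms :=
  (satisfies ρ).preservesEpimorphisms_ι_of_isNormalMonoCategory

instance [IsNoetherianRing R] (ρ : Set (Relation R Q)) :
    (finiteStalks ρ).IsClosedUnderSubobjects where
  prop_of_mono {V W} f _ hW x := by
    have : Module.Finite R ((stalk ρ x).obj W) := hW x
    have hf : Mono ((stalk ρ x).map f) := inferInstance
    exact Module.Finite.of_injective ((stalk ρ x).map f).hom
      ((ModuleCat.mono_iff_injective _).1 hf)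

instance (ρ : Set (Relation R Q)) : (finiteStalks ρ).IsClosedUnderQuotients where
  prop_of_epi {V W} f _ hV x := by
    have : Module.Finite R ((stalk ρ x).obj V) := hV x
    have hf : Epi ((stalk ρ x).map f) := inferInstance
    exact Module.Finite.of_surjective ((stalk ρ x).map f).hom
      ((ModuleCat.epi_iff_surjective _).1 hf)

instance (ρ : Set (Relation R Q)) : (finiteStalks ρ).ContainsZero where
  exists_zero := by
    obtain ⟨Z, hZ⟩ := HasZeroObject.zero (C := RepRel ρ)
    refine ⟨Z, hZ, fun x ↦ ?_⟩
    have : Subsingleton ((stalk ρ x).obj Z) :=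
      ModuleCat.isZero_iff_subsingleton.1 ((stalk ρ x).map_isZero hZ)
    exact inferInstanceAs (Module.Finite R ((stalk ρ x).obj Z))

instance (ρ : Set (Relation R Q)) : (satisfies ρ).ι.PreservesHomology where
  preservesKernels _ _ f := (satisfies ρ).preservesKernels_ι f
  preservesCokernels _ _ f := (satisfies ρ).preservesCokernels_ι f

instance (ρ : Set (Relation R Q)) : PreservesFiniteLimits (satisfies ρ).ι :=
  (satisfies ρ).ι.preservesFiniteLimits_of_preservesHomology

instance [IsNoetherianRing R] (ρ : Set (Relation R Q)) :
    (finiteStalks ρ).IsClosedUnderFiniteProducts where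
  isClosedUnderLimitsOfShape J _ :=
    { limitsOfShape_le := by
        rintro V ⟨h⟩ x
        have hl := isLimitOfPreserves (stalk ρ x) h.isLimit
        have (j : J) : Module.Finite R ((stalk ρ x).obj (h.diag.obj ⟨j⟩)) :=
          h.prop_diag_obj ⟨j⟩ x
        let φ : (stalk ρ x).obj V →ₗ[R] (∀ j : J, (stalk ρ x).obj (h.diag.obj ⟨j⟩)) :=
          LinearMap.pi fun j ↦ ((stalk ρ x).map (h.π.app ⟨j⟩)).hom
        refine Module.Finite.of_injective φ fun a b hab ↦ ?_
        exact Concrete.isLimit_ext _ hl _ _ fun j ↦ congr_fun hab j.as }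

instance [IsNoetherianRing R] (ρ : Set (Relation R Q)) : Abelian (RepRelFin ρ) := inferInstance

instance [IsNoetherianRing R] (ρ : Set (Relation R Q)) :
    (finiteStalks ρ).ι.PreservesHomology where
  preservesKernels _ _ f := (finiteStalks ρ).preservesKernels_ι f
  preservesCokernels _ _ f := (finiteStalks ρ).preservesCokernels_ι f

instance [IsNoetherianRing R] (ρ : Set (Relation R Q)) :
    PreservesFiniteLimits (finiteStalks ρ).ι :=
  (finiteStalks ρ).ι.preservesFiniteLimits_of_preservesHomology

instance [IsNoetherianRing R] (ρ : Set (Relation R Q)) :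
    PreservesFiniteColimits (finiteStalks ρ).ι :=
  (finiteStalks ρ).ι.preservesFiniteColimits_of_preservesHomology

end QuiverRep

/-! ### Sheaves of `R`-modules and their cohomology -/

namespace SheafMod

variable (R : Type u) [CommRing R] {X : TopCat.{u}}

/-- The category of sheaves of `R`-modules on `X`. -/
abbrev Sh (X : TopCat.{u}) := X.Sheaf (ModuleCat.{u} R)

/-- The functor of sections `Γ(U, -)`. -/
abbrev sections (U : Opens X) : Sh R X ⥤ ModuleCat.{u} R :=
  TopCat.Sheaf.forget _ X ⋙ (evaluation _ _).obj (op U)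

instance (U : Opens X) : (sections R U).Additive where
  map_add := rfl

/-- Sheaf cohomology `Hⁱ(U, -)`: the `i`-th right derived functor of `Γ(U, -)`. -/
abbrev cohomology (U : Opens X) (i : ℕ) : Sh R X ⥤ ModuleCat.{u} R :=
  (sections R U).rightDerived i

/-- `X` has finite homological dimension (for sheaves of `R`-modules): there is an `n` such that
`Hⁱ(X, F) = 0` for all `i > n` and all sheaves `F` of `R`-modules. -/
def FiniteHomologicalDimension (X : TopCat.{u}) : Prop :=
  ∃ n : ℕ, ∀ i > n, ∀ F : Sh R X, IsZero ((cohomology R (⊤ : Opens X) i).obj F)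

end SheafMod

/-- The ring `R` has finite homological (i.e. global) dimension. -/
def RingFiniteHomologicalDimension (R : Type u) [CommRing R] : Prop :=
  ∃ n : ℕ, ∀ M : ModuleCat.{u} R, HasProjectiveDimensionLE M n

/-! ### Stratifications and constructible sheaves -/

/-- A topological manifold: a Hausdorff space that is locally homeomorphic to `ℝⁿ`. -/
def IsTopologicalManifold (M : Type u) [TopologicalSpace M] : Prop :=
  T2Space M ∧ ∃ n : ℕ, Nonempty (ChartedSpace (EuclideanSpace ℝ (Fin n)) M)

/-- A finite stratification of `X` into locally closed, simply connected topological manifolds,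
such that the closure of any stratum is a union of strata. -/
structure Stratification (X : TopCat.{u}) where
  /-- the set of strata -/
  strata : Set (Set X)
  finite : strata.Finite
  isPartition : Setoid.IsPartition strata
  isManifold : ∀ S ∈ strata, IsTopologicalManifold S
  simplyConnected : ∀ S ∈ strata, SimplyConnectedSpace S
  isLocallyClosed : ∀ S ∈ strata, IsLocallyClosed S
  closure_eq_sUnion : ∀ S ∈ strata, ∃ A ⊆ strata, closure S = ⋃₀ A

namespace Stratification

open SheafMod QuiverRep

variable {X : TopCat.{u}} (𝒮 : Stratification X)

/-- The star of a stratum `S`: the union of all strata whose closure contains `S`. -/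
def starSet (S : Set X) : Set X := ⋃₀ {T ∈ 𝒮.strata | S ⊆ closure T}

lemma isOpen_starSet (S : Set X) : IsOpen (𝒮.starSet S) := by
  have key : (𝒮.starSet S)ᶜ = ⋃ T ∈ {T ∈ 𝒮.strata | ¬ S ⊆ closure T}, closure T := by
    ext x
    simp only [starSet, Set.mem_compl_iff, Set.mem_sUnion, Set.mem_ofPred_eq, Set.mem_iUnion,
      exists_prop, not_exists, not_and]
    constructor
    · intro hx
      obtain ⟨T, ⟨hT, hxT⟩, -⟩ := 𝒮.isPartition.2 x
      exact ⟨T, ⟨hT, fun h ↦ hx T ⟨hT, h⟩ hxT⟩, subset_closure hxT⟩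
    · rintro ⟨T, ⟨hT, hST⟩, hxT⟩ T' ⟨hT', hST'⟩ hxT'
      obtain ⟨A, hA, hTA⟩ := 𝒮.closure_eq_sUnion T hT
      obtain ⟨T'', hT'', hx''⟩ : x ∈ ⋃₀ A := hTA ▸ hxT
      have h : T' = T'' := (𝒮.isPartition.2 x).unique ⟨hT', hxT'⟩ ⟨hA hT'', hx''⟩
      have hsub : T' ⊆ closure T := by
        rw [hTA, h]
        exact Set.subset_sUnion_of_mem hT''
      exact hST (hST'.trans (closure_minimal hsub isClosed_closure))
  rw [← isClosed_compl_iff, key]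
  exact (𝒮.finite.subset (Set.sep_subset _ _)).isClosed_biUnion fun T _ ↦ isClosed_closure

/-- The vertices of the quiver of strata: the strata. -/
def Vertex : Type u := 𝒮.strata

/-- There is exactly one arrow from `S` to `T` if `S ⊆ closure T`, and none otherwise. -/
instance : Quiver.{0} 𝒮.Vertex where
  Hom S T := PLift (S.1 ⊆ closure T.1)

/-- The star of a stratum, as an open subset of `X`. -/
def star (S : 𝒮.Vertex) : Opens X := ⟨𝒮.starSet S.1, 𝒮.isOpen_starSet S.1⟩

lemma mem_star {S : 𝒮.Vertex} {x : X} (hx : x ∈ S.1) : x ∈ 𝒮.star S :=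
  Set.mem_sUnion_of_mem hx ⟨S.2, subset_closure⟩

lemma star_le {S T : 𝒮.Vertex} (h : S.1 ⊆ closure T.1) : 𝒮.star T ≤ 𝒮.star S := by
  rintro x ⟨T', ⟨hT', hTT'⟩, hx⟩
  exact ⟨T', ⟨hT', h.trans (closure_minimal hTT' isClosed_closure)⟩, hx⟩

section

variable (R : Type u) [CommRing R]

/-- The relations on the quiver of strata that identify any two parallel paths. -/
def relations : Set (Relation R 𝒮.Vertex) :=
  {r | ∃ (S T : Paths 𝒮.Vertex) (p q : S ⟶ T),
    r = ⟨S, T, Finsupp.single p 1 - Finsupp.single q 1⟩}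

/-- The category of representations of the quiver of strata with relations. -/
abbrev RepStrata := RepRel (𝒮.relations R)

/-- The category of representations with finitely generated stalks of the quiver of strata with
relations. -/
abbrev RepStrataFin := RepRelFin (𝒮.relations R)

variable {R} in
/-- A sheaf is weakly constructible if its restriction to every stratum is a constant sheaf. -/
def weaklyConstructible : ObjectProperty (Sh R X) := fun F ↦ ∀ S ∈ 𝒮.strata,
  Sheaf.IsConstant (Opens.grothendieckTopology (TopCat.of S))
    ((TopCat.Sheaf.pullback (ModuleCat.{u} R)
      (TopCat.ofHom (⟨Subtype.val, continuous_subtype_val⟩ : C(S, X)))).obj F)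

variable {R} in
/-- A sheaf is constructible if it is weakly constructible and all its stalks are finitely
generated. -/
def constructible : ObjectProperty (Sh R X) := fun F ↦
  𝒮.weaklyConstructible F ∧ ∀ x : X, Module.Finite R (F.presheaf.stalk x)

/-- A stratification is acyclic (over `R`) if for every weakly constructible sheaf `F` and every
stratum `S` the map `Γ(star S, F) ⟶ Fₓ` is an isomorphism for all `x ∈ S`, and
`Hⁱ(star S, F) = 0` for all `i > 0`. -/
structure IsAcyclic : Prop where
  isIso_germ : ∀ F : Sh R X, 𝒮.weaklyConstructible F → ∀ (S : 𝒮.Vertex) (x : X) (hx : x ∈ S.1),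
    IsIso (F.presheaf.germ (𝒮.star S) x (𝒮.mem_star hx))
  isZero_cohomology : ∀ F : Sh R X, 𝒮.weaklyConstructible F → ∀ (S : 𝒮.Vertex), ∀ i > 0,
    IsZero ((cohomology R (𝒮.star S) i).obj F)

/-- The stars, as a functor on the path category of the quiver of strata. -/
def starFunctor : Paths 𝒮.Vertex ⥤ (Opens X)ᵒᵖ :=
  Paths.lift
    { obj := fun S ↦ op (𝒮.star S)
      map := fun {_ _} f ↦ (homOfLE (𝒮.star_le f.down)).op }

/-- The functor that sends a sheaf `F` to the representation with stalk `Γ(star S, F)` at the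
vertex `S`, on which the arrows act by restriction. -/
def toRep : Sh R X ⥤ 𝒮.RepStrata R :=
  (satisfies (𝒮.relations R)).lift
    (TopCat.Sheaf.forget _ X ⋙ (Functor.whiskeringLeft _ _ _).obj 𝒮.starFunctor) (by
      rintro F _ ⟨S, T, p, q, rfl⟩
      have h : 𝒮.starFunctor.map p = 𝒮.starFunctor.map q := Subsingleton.elim _ _
      simp only [actRelation]
      rw [Finsupp.sum_sub_index (by intros; rw [sub_smul])]
      simp [h])

instance : (𝒮.toRep R).Additive where

end

section

variable {R : Type u} [CommRing R] [HasDerivedCategory.{w₁} (Sh R X)]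

/-- The property of an object of `D⁺(X)` that all its cohomology sheaves satisfy `P`. -/
def cohomologyPlus (P : ObjectProperty (Sh R X)) :
    ObjectProperty (DerivedCategory.Plus (Sh R X)) :=
  fun K ↦ ∀ n : ℤ, P ((DerivedCategory.homologyFunctor (Sh R X) n).obj K.obj)

/-- The property of an object of `Dᵇ(X)` that all its cohomology sheaves satisfy `P`. -/
def cohomologyBounded (P : ObjectProperty (Sh R X)) :
    ObjectProperty (DerivedCategory.Bounded (Sh R X)) :=
  fun K ↦ ∀ n : ℤ, P ((DerivedCategory.homologyFunctor (Sh R X) n).obj K.obj)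

end

section

variable (R : Type u) [CommRing R] [HasDerivedCategory.{w₁} (Sh R X)]

/-- `D⁺_{w,c}(X)`. -/
abbrev DPlusWC := (cohomologyPlus (𝒮.weaklyConstructible (R := R))).FullSubcategory

/-- `Dᵇ_{w,c}(X)`. -/
abbrev DBoundedWC := (cohomologyBounded (𝒮.weaklyConstructible (R := R))).FullSubcategory

/-- `Dᵇ_c(X)`. -/
abbrev DBoundedC := (cohomologyBounded (𝒮.constructible (R := R))).FullSubcategory

/-- The inclusion `Dᵇ(X) ⥤ D⁺(X)`. -/
abbrev boundedToPlus (X : TopCat.{u}) [HasDerivedCategory.{w₁} (Sh R X)] :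
    DerivedCategory.Bounded (Sh R X) ⥤ DerivedCategory.Plus (Sh R X) :=
  ObjectProperty.ιOfLE inf_le_left

end

end Stratification

end

noncomputable section

namespace Stratification

open SheafMod QuiverRep

variable {X : TopCat.{u}} (𝒮 : Stratification X)

/-! ### Combinatorics of strata -/

/-! Write Φ for `toRep`. It has a left adjoint L = `ofRep`, left Kan extension along the stars
followed by sheafification. By Yoneda against skyscraper sheaves, the stalk of L V at a point of S
is V_S (`isIso_toStalk`), so L is exact and reflects isomorphisms. The same argument against
pushforwards from S shows that L V is constant on S, so L V is weakly constructible. None of this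
needs acyclicity.

On the stalk at a point x of S the counit LΦF → F is the germ map Γ(star S, F) → F_x, so acyclicity
makes it an isomorphism for weakly constructible F. It is then a quasi-isomorphism for every bounded
below complex K of injectives with weakly constructible cohomology
(`IsAcyclic.quasiIso_counitCochain`): the vanishing of higher cohomology on stars lets Γ(star S, -)
commute with the cohomology of K.

The first equivalence is now formal. RΦ is computed by Φ on complexes of injectives, and Φ preserves
injectives because L is exact; inverting the counit gives full faithfulness. If L V → I is an
injective resolution, the adjoint map V → ΦI is a quasi-isomorphism because L detects this, which
gives essential surjectivity. Since L RΦ K ≅ K and L is exact, L carries the cohomology of RΦ K to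
that of K; so boundedness and finite generation can be read on either side
(`IsAcyclic.essImage_rightDerivedBounded_iff`).

It remains to see that Dᵇ(Rep_f) → D(Rep) is fully faithful, with image the bounded complexes with
finitely generated cohomology (`essImage_bounded_mapDerivedCategory_iff`). This holds because Rep_f
has enough projectives, which stay projective in Rep; truncation reduces the claim to single
objects. -/

lemma subset_closure_of_mem_star {S T : 𝒮.Vertex} {x : X} (hx : x ∈ S.1) (hT : x ∈ 𝒮.star T) :
    T.1 ⊆ closure S.1 := by
  obtain ⟨T', ⟨hT', hTT'⟩, hx'⟩ := hT
  obtain rfl : S.1 = T' := (𝒮.isPartition.2 x).unique ⟨S.2, hx⟩ ⟨hT', hx'⟩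
  exact hTT'

lemma exists_vertex_mem (x : X) : ∃ S : 𝒮.Vertex, x ∈ S.1 := by
  obtain ⟨T, ⟨hT, hx⟩, -⟩ := 𝒮.isPartition.2 x
  exact ⟨⟨T, hT⟩, hx⟩

lemma exists_mem_vertex (S : 𝒮.Vertex) : ∃ x : X, x ∈ S.1 :=
  Set.nonempty_iff_ne_empty.2 fun h ↦ 𝒮.isPartition.1 (h ▸ S.2)

instance : Finite 𝒮.Vertex := 𝒮.finite

/-- The path of length one given by an inclusion of a stratum in a closure. -/
def path {S T : Paths 𝒮.Vertex} (h : S.1 ⊆ closure T.1) : S ⟶ T :=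
  (Paths.of 𝒮.Vertex).map (X := S) (Y := T) ⟨h⟩

lemma subset_closure_of_path {S T : Paths 𝒮.Vertex} (p : S ⟶ T) : S.1 ⊆ closure T.1 := by
  refine Paths.induction_fixed_source (fun {T} _ ↦ S.1 ⊆ closure T.1) subset_closure ?_ p
  intro U T p e ih
  exact ih.trans (closure_minimal e.down isClosed_closure)

section

variable {R : Type u} [CommRing R]

/-- The relation `p - q` is among those imposed, so a representation is in effect a functor on the
preorder of strata. -/
lemma RepStrata.map_eq (V : 𝒮.RepStrata R) {S T : Paths 𝒮.Vertex} (p q : S ⟶ T) :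
    V.obj.map p = V.obj.map q := by
  have h := V.property ⟨S, T, Finsupp.single p 1 - Finsupp.single q 1⟩ ⟨S, T, p, q, rfl⟩
  simp only [actRelation] at h
  rw [Finsupp.sum_sub_index (by intros; rw [sub_smul])] at h
  simpa [sub_eq_zero] using h

/-- A presheaf that vanishes on the stars of the strata outside the closure of `S`. -/
structure IsSupportedBelow (P : TopCat.Presheaf (ModuleCat.{u} R) X) (S : 𝒮.Vertex) : Prop where
  isZero : ∀ T : 𝒮.Vertex, ¬ T.1 ⊆ closure S.1 → IsZero (P.obj (op (𝒮.star T)))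
  isIso : ∀ (T : 𝒮.Vertex) (h : T.1 ⊆ closure S.1),
    IsIso (P.map (homOfLE (𝒮.star_le h)).op)

lemma starFunctor_map_path {S T : Paths 𝒮.Vertex} (h : S.1 ⊆ closure T.1) :
    𝒮.starFunctor.map (𝒮.path h) = (homOfLE (𝒮.star_le (S := S) (T := T) h)).op :=
  Subsingleton.elim _ _

variable {𝒮} in
lemma IsSupportedBelow.isIso_map_path {P : TopCat.Presheaf (ModuleCat.{u} R) X}
    {S : Paths 𝒮.Vertex} (hP : 𝒮.IsSupportedBelow P S) {T : Paths 𝒮.Vertex}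
    (h : T.1 ⊆ closure S.1) : IsIso ((𝒮.starFunctor ⋙ P).map (𝒮.path h)) := by
  rw [Functor.comp_map, 𝒮.starFunctor_map_path h]
  exact hP.isIso T h

variable {𝒮} in
-- On stars, `P` is the right Kan extension of its value at `S`. At `T` below `S` a component is
-- forced to be V_T → V_S → P_S ≅ P_T; at the other `T` the target is zero.
lemma IsSupportedBelow.bijective {P : TopCat.Presheaf (ModuleCat.{u} R) X} {S : Paths 𝒮.Vertex}
    (hP : 𝒮.IsSupportedBelow P S) (V : 𝒮.RepStrata R) :
    Function.Bijective fun (f : V.obj ⟶ 𝒮.starFunctor ⋙ P) ↦ f.app S := by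
  classical
  constructor
  · intro f g hfg
    ext1
    funext T
    by_cases h : T.1 ⊆ closure S.1
    · have := hP.isIso_map_path h
      rw [← cancel_mono ((𝒮.starFunctor ⋙ P).map (𝒮.path h)), ← f.naturality, ← g.naturality]
      exact congr_arg _ hfg
    · exact (hP.isZero T h).eq_of_tgt _ _
  · intro a
    refine ⟨{ app T := if h : T.1 ⊆ closure S.1 then
                haveI := hP.isIso_map_path h
                V.obj.map (𝒮.path h) ≫ a ≫ inv ((𝒮.starFunctor ⋙ P).map (𝒮.path h)) else 0
              naturality := ?_ }, ?_⟩
    · intro T T' p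
      by_cases h' : T'.1 ⊆ closure S.1
      · have h : T.1 ⊆ closure S.1 :=
          (𝒮.subset_closure_of_path p).trans (closure_minimal h' isClosed_closure)
        have := hP.isIso_map_path h
        have := hP.isIso_map_path h'
        rw [dif_pos h, dif_pos h', ← cancel_mono ((𝒮.starFunctor ⋙ P).map (𝒮.path h'))]
        simp only [Category.assoc, IsIso.inv_hom_id, Category.comp_id]
        rw [← (𝒮.starFunctor ⋙ P).map_comp, ← V.obj.map_comp_assoc,
          show (𝒮.starFunctor ⋙ P).map (p ≫ 𝒮.path h') = (𝒮.starFunctor ⋙ P).map (𝒮.path h) from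
            congr_arg P.map (Subsingleton.elim _ _), IsIso.inv_hom_id, Category.comp_id,
          RepStrata.map_eq 𝒮 V (p ≫ 𝒮.path h') (𝒮.path h)]
      · exact (hP.isZero T' h').eq_of_tgt _ _
    · have := hP.isIso_map_path (subset_closure (s := S.1))
      dsimp only
      rw [dif_pos subset_closure, RepStrata.map_eq 𝒮 V _ (𝟙 _), V.obj.map_id, Category.id_comp,
        IsIso.comp_inv_eq, show (𝒮.starFunctor ⋙ P).map (𝒮.path (subset_closure (s := S.1))) = 𝟙 _
          from (congr_arg P.map (Subsingleton.elim _ (𝟙 _))).trans (P.map_id _), Category.comp_id]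

/-! ### The left adjoint of `toRep` -/

variable (R)

/-- The left adjoint of `toRep`. -/
def ofRep : 𝒮.RepStrata R ⥤ Sh R X :=
  (satisfies (𝒮.relations R)).ι ⋙ 𝒮.starFunctor.lan ⋙
    presheafToSheaf (Opens.grothendieckTopology X) (ModuleCat.{u} R)

/-- The adjunction between `ofRep` and `toRep`. -/
def repAdjunction : 𝒮.ofRep R ⊣ 𝒮.toRep R :=
  ((𝒮.starFunctor.lanAdjunction (ModuleCat.{u} R)).comp
    (sheafificationAdjunction (Opens.grothendieckTopology X)
      (ModuleCat.{u} R))).restrictFullyFaithful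
        (satisfies (𝒮.relations R)).fullyFaithfulι (Functor.FullyFaithful.id _)
        (Iso.refl _) (Iso.refl _)

variable {R}

/-- The stalk at a point of a sheaf, as a functor. -/
abbrev stalkAt (x : X) : Sh R X ⥤ ModuleCat.{u} R :=
  TopCat.Sheaf.forget _ X ⋙ TopCat.Presheaf.stalkFunctor _ x

/-- The stalk of a representation at the stratum `S`, as a functor. -/
def repStalk (S : 𝒮.Vertex) : 𝒮.RepStrata R ⥤ ModuleCat.{u} R := stalk (𝒮.relations R) S

/-- The stalk at `S` of the representation attached to a sheaf consists of the sections on the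
star of `S`. -/
def toRepCompStalkIso (S : 𝒮.Vertex) :
    𝒮.toRep R ⋙ 𝒮.repStalk S ≅ sections R (𝒮.star S) :=
  Iso.refl _

/-- The germ at a point of `S` of a section on the star of `S`, as a natural transformation. -/
def germStar (S : 𝒮.Vertex) (x : X) (hx : x ∈ S.1) :
    sections R (𝒮.star S) ⟶ stalkAt (R := R) x where
  app F := F.presheaf.germ (𝒮.star S) x (𝒮.mem_star hx)
  naturality _ _ f := (TopCat.Presheaf.stalkFunctor_map_germ _ _ _ f.hom).symm

/-- The map from the stalk of a representation to the stalk of the associated sheaf. -/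
def toStalk (S : 𝒮.Vertex) (x : X) (hx : x ∈ S.1) :
    𝒮.repStalk (R := R) S ⟶ 𝒮.ofRep R ⋙ stalkAt x where
  app V := (𝒮.repStalk S).map ((𝒮.repAdjunction R).unit.app V) ≫
    (𝒮.toRepCompStalkIso S).hom.app ((𝒮.ofRep R).obj V) ≫ (𝒮.germStar S x hx).app _
  naturality V W f := by
    have h₁ := congr_arg (𝒮.repStalk S).map ((𝒮.repAdjunction R).unit.naturality f)
    have h₂ := ((𝒮.toRepCompStalkIso S).hom ≫ 𝒮.germStar S x hx).naturality ((𝒮.ofRep R).map f)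
    simp only [Functor.map_comp, Functor.comp_map, NatTrans.comp_app, Functor.id_map] at h₁ h₂
    simp only [reassoc_of% h₁, Category.assoc]
    rw [h₂, Category.assoc, Functor.comp_map, Functor.comp_map]

open Classical in
-- The point `x` lies in the star of `T` exactly when `T` lies in the closure of `S`; there the
-- skyscraper is `M`, elsewhere it is terminal.
lemma isSupportedBelow_skyscraper (M : ModuleCat.{u} R) (S : 𝒮.Vertex) (x : X) (hx : x ∈ S.1) :
    𝒮.IsSupportedBelow (skyscraperPresheaf x M) S where
  isZero T hT := by
    have : x ∉ 𝒮.star T := fun h ↦ hT (𝒮.subset_closure_of_mem_star hx h)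
    exact ((if_neg this).symm.ndrec terminalIsTerminal : IsTerminal _).isZero
  isIso T hT := by
    have : x ∈ 𝒮.star S := 𝒮.mem_star hx
    rw [skyscraperPresheaf_map, dif_pos this]
    exact (eqToIso (C := ModuleCat.{u} R) (by
      rw [skyscraperPresheaf_obj, skyscraperPresheaf_obj, if_pos this,
        if_pos (𝒮.star_le hT this)])).isIso_hom

/-- The map on sections over the star of `S` of a morphism from a sheaf associated to a
representation. -/
def sectionsOfHom (V : 𝒮.RepStrata R) (S : 𝒮.Vertex) {G : Sh R X} (f : (𝒮.ofRep R).obj V ⟶ G) :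
    (𝒮.repStalk S).obj V ⟶ (sections R (𝒮.star S)).obj G :=
  (𝒮.repStalk S).map ((𝒮.repAdjunction R).unit.app V) ≫
    (𝒮.toRepCompStalkIso S).hom.app ((𝒮.ofRep R).obj V) ≫ (sections R (𝒮.star S)).map f

variable {𝒮} in
-- The adjunction turns maps of sheaves into maps of representations, which are determined at `S`.
-- Both the stalks of `ofRep` and its restrictions to strata are computed from this.
lemma IsSupportedBelow.bijective_sectionsOfHom {G : Sh R X} {S : 𝒮.Vertex}
    (hG : 𝒮.IsSupportedBelow G.presheaf S) (V : 𝒮.RepStrata R) :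
    Function.Bijective (𝒮.sectionsOfHom V S (G := G)) := by
  have h := (hG.bijective V).comp ((InducedCategory.homEquiv.bijective).comp
    ((𝒮.repAdjunction R).homEquiv V G).bijective)
  convert! h using 1

open StalkSkyscraperPresheafAdjunctionAuxs in
-- Yoneda in `M`: maps from the stalk at `x` to `M` are maps to the skyscraper sheaf, hence maps V_S
-- → M.
instance isIso_toStalk_app (V : 𝒮.RepStrata R) (S : 𝒮.Vertex) (x : X) (hx : x ∈ S.1) :
    IsIso ((𝒮.toStalk S x hx).app V) := by
  classical
  refine isIso_of_coyoneda_map_bijective _ fun M ↦ ?_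
  let φ (f : (𝒮.ofRep R).obj V ⟶ skyscraperSheaf x M) :
    (𝒮.ofRep R ⋙ stalkAt x).obj V ⟶ M := fromStalk x f.hom
  have hφ : Function.Bijective φ := by
    refine Function.bijective_iff_has_inverse.2 ⟨fun g ↦ ⟨toSkyscraperPresheaf x g⟩, ?_, ?_⟩
    · exact fun f ↦ InducedCategory.hom_ext (to_skyscraper_fromStalk x f.hom)
    · exact fun g ↦ fromStalk_to_skyscraper x g
  let e : (sections R (𝒮.star S)).obj (skyscraperSheaf x M) ≅ M :=
    eqToIso (if_pos (𝒮.mem_star hx))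
  have h := (Iso.homCongr (Iso.refl ((𝒮.repStalk S).obj V)) e).bijective.comp
    (IsSupportedBelow.bijective_sectionsOfHom (G := skyscraperSheaf x M)
      (𝒮.isSupportedBelow_skyscraper M S x hx) V)
  rw [← Function.Bijective.of_comp_iff _ hφ]
  convert! h using 1
  funext f
  -- This identifies the composite bijection with precomposition by `toStalk`.
  have he : (𝒮.germStar S x hx).app ((𝒮.ofRep R).obj V) ≫ φ f =
    (sections R (𝒮.star S)).map f ≫ e.hom := germ_fromStalk x f.hom _ (𝒮.mem_star hx)
  simp only [Function.comp_apply, Iso.homCongr_apply, Iso.refl_inv, Category.id_comp]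
  simp only [toStalk, sectionsOfHom, Category.assoc, he]

instance isIso_toStalk (S : 𝒮.Vertex) (x : X) (hx : x ∈ S.1) :
    IsIso (𝒮.toStalk (R := R) S x hx) :=
  NatIso.isIso_of_isIso_app _

end
end Stratification

namespace Stratification

open SheafMod QuiverRep

variable {X : TopCat.{u}} (𝒮 : Stratification X)

section

variable {R : Type u} [CommRing R]

/-! ### Exactness -/

lemma preservesFiniteLimits_stalk (S : Paths 𝒮.Vertex) :
    PreservesFiniteLimits (stalk (𝒮.relations R) S) :=
  have : PreservesFiniteLimits ((evaluation (Paths 𝒮.Vertex) (ModuleCat.{u} R)).obj S) :=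
    ⟨fun _ _ _ ↦ inferInstance⟩
  comp_preservesFiniteLimits _ _

lemma preservesFiniteColimits_stalk (S : Paths 𝒮.Vertex) :
    PreservesFiniteColimits (stalk (𝒮.relations R) S) :=
  have : PreservesFiniteColimits ((evaluation (Paths 𝒮.Vertex) (ModuleCat.{u} R)).obj S) :=
    ⟨fun _ _ _ ↦ inferInstance⟩
  have : PreservesFiniteColimits (satisfies (𝒮.relations R)).ι :=
    (satisfies (𝒮.relations R)).ι.preservesFiniteColimits_of_preservesHomology
  comp_preservesFiniteColimits _ _

instance (S : 𝒮.Vertex) : PreservesFiniteLimits (𝒮.repStalk (R := R) S) :=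
  𝒮.preservesFiniteLimits_stalk S

instance (S : 𝒮.Vertex) : PreservesFiniteColimits (𝒮.repStalk (R := R) S) :=
  𝒮.preservesFiniteColimits_stalk S

instance (S : 𝒮.Vertex) : (𝒮.repStalk (R := R) S).Additive :=
  Functor.additive_of_preserves_binary_products _

lemma isIso_of_isIso_repStalk_map {V W : 𝒮.RepStrata R} (f : V ⟶ W)
    (hf : ∀ S, IsIso ((𝒮.repStalk S).map f)) : IsIso f := by
  have : IsIso ((satisfies (𝒮.relations R)).ι.map f) := by
    rw [NatTrans.isIso_iff_isIso_app]
    exact hf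
  exact isIso_of_reflects_iso f (satisfies (𝒮.relations R)).ι

lemma isIso_of_isIso_stalkAt_map {F G : Sh R X} (f : F ⟶ G)
    (hf : ∀ x, IsIso ((stalkAt x).map f)) : IsIso f :=
  (TopCat.Presheaf.isIso_iff_stalkFunctor_map_iso f).2 hf

instance : (𝒮.ofRep R).Additive := (𝒮.repAdjunction R).left_adjoint_additive

instance : PreservesFiniteColimits (𝒮.ofRep R) :=
  have := (𝒮.repAdjunction R).leftAdjoint_preservesColimits
  inferInstance

/-- Exactness of sheaves is tested on stalks, where `ofRep` becomes the exact functor `repStalk`. -/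
lemma exact_map_ofRep {C : ShortComplex (𝒮.RepStrata R)} (hC : C.Exact) :
    (C.map (𝒮.ofRep R)).Exact := by
  rw [TopCat.Sheaf.exact_iff_stalkFunctor_map_exact]
  intro x
  obtain ⟨S, hx⟩ := 𝒮.exists_vertex_mem x
  exact (ShortComplex.exact_iff_of_iso
    (C.mapNatIso (asIso (𝒮.toStalk S x hx)))).1 (hC.map (𝒮.repStalk S))

instance : (𝒮.ofRep R).PreservesHomology :=
  ((𝒮.ofRep R).exact_tfae.out 1 2).1 fun _ h ↦ 𝒮.exact_map_ofRep h

instance : PreservesFiniteLimits (𝒮.ofRep R) :=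
  (𝒮.ofRep R).preservesFiniteLimits_of_preservesHomology

/-- Strata are non-empty, so every stalk of a representation occurs as a stalk of the sheaf. -/
instance : (𝒮.ofRep R).ReflectsIsomorphisms where
  reflects {V W} f hf := by
    refine 𝒮.isIso_of_isIso_repStalk_map f fun S ↦ ?_
    obtain ⟨x, hx⟩ := 𝒮.exists_mem_vertex S
    have : IsIso ((𝒮.ofRep R ⋙ stalkAt x).map f) :=
      inferInstanceAs (IsIso ((stalkAt x).map ((𝒮.ofRep R).map f)))
    exact ((NatIso.isIso_map_iff (asIso (𝒮.toStalk (R := R) S x hx)) f).2 this)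

/-! ### The counit on weakly constructible sheaves -/

/-- By a triangle identity, the counit on stalks is the germ map from the star up to the isomorphism
`toStalk`; this is where the first acyclicity condition applies. -/
lemma toStalk_app_comp_stalkAt_map_counit (F : Sh R X) (S : 𝒮.Vertex) (x : X) (hx : x ∈ S.1) :
    (𝒮.toStalk S x hx).app ((𝒮.toRep R).obj F) ≫
      (stalkAt x).map ((𝒮.repAdjunction R).counit.app F) =
        (𝒮.toRepCompStalkIso S).hom.app F ≫ (𝒮.germStar S x hx).app F := by
  have h := ((𝒮.toRepCompStalkIso S).hom ≫ 𝒮.germStar S x hx).naturality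
    ((𝒮.repAdjunction R).counit.app F)
  simp only [NatTrans.comp_app, Category.assoc] at h
  simp only [toStalk, Category.assoc]
  erw [← h]
  rw [Functor.comp_map, ← Functor.map_comp_assoc,
    (𝒮.repAdjunction R).right_triangle_components F]
  exact (congr_arg (· ≫ _) ((𝒮.repStalk S).map_id _)).trans (Category.id_comp _)

variable {𝒮} in
lemma IsAcyclic.isIso_counit_app (h : 𝒮.IsAcyclic R) (F : Sh R X)
    (hF : 𝒮.weaklyConstructible F) : IsIso ((𝒮.repAdjunction R).counit.app F) := by
  refine isIso_of_isIso_stalkAt_map _ fun x ↦ ?_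
  obtain ⟨S, hx⟩ := 𝒮.exists_vertex_mem x
  have h₁ : IsIso ((𝒮.germStar S x hx).app F) := h.isIso_germ F hF S x hx
  have h₂ : IsIso ((𝒮.toStalk S x hx).app ((𝒮.toRep R).obj F) ≫
      (stalkAt x).map ((𝒮.repAdjunction R).counit.app F)) := by
    rw [toStalk_app_comp_stalkAt_map_counit]
    infer_instance
  exact IsIso.of_isIso_comp_left ((𝒮.toStalk S x hx).app ((𝒮.toRep R).obj F)) _

/-! ### Sheaves associated to representations are weakly constructible -/

lemma sectionsOfHom_comp (V : 𝒮.RepStrata R) (S : 𝒮.Vertex) {G H : Sh R X}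
    (f : (𝒮.ofRep R).obj V ⟶ G) (g : G ⟶ H) :
    𝒮.sectionsOfHom V S (f ≫ g) = 𝒮.sectionsOfHom V S f ≫ (sections R (𝒮.star S)).map g := by
  simp only [sectionsOfHom, Functor.map_comp, Category.assoc]

/-- The inclusion of a stratum. -/
abbrev incl (S : 𝒮.Vertex) : TopCat.of S.1 ⟶ X :=
  TopCat.ofHom (⟨Subtype.val, continuous_subtype_val⟩ : C(S.1, X))

/-- The star of `T` contains `S` if `T` lies in the closure of `S`, and is disjoint from `S`
otherwise. -/
lemma isSupportedBelow_pushforward (S : 𝒮.Vertex) (G : Sh R (TopCat.of S.1)) :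
    𝒮.IsSupportedBelow ((TopCat.Sheaf.pushforward _ (𝒮.incl S)).obj G).presheaf S where
  isZero T hT := by
    have : (Opens.map (𝒮.incl S)).obj (𝒮.star T) = ⊥ :=
      le_bot_iff.1 fun x hx ↦ hT (𝒮.subset_closure_of_mem_star x.2 hx)
    exact (G.isTerminalOfEqEmpty this).isZero
  isIso T hT := by
    have h : (Opens.map (𝒮.incl S)).obj (𝒮.star T) ≤ (Opens.map (𝒮.incl S)).obj (𝒮.star S) :=
      fun x _ ↦ 𝒮.mem_star x.2
    have : IsIso ((Opens.map (𝒮.incl S)).op.map (homOfLE (𝒮.star_le hT)).op) :=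
      ⟨(homOfLE h).op, Subsingleton.elim _ _, Subsingleton.elim _ _⟩
    exact inferInstanceAs (IsIso (G.presheaf.map _))

/-- Yoneda in a sheaf `G` on the stratum: maps from the restriction to `G` are maps to the
pushforward of `G`, hence maps V_S → Γ(S, G), hence maps from the constant sheaf V_S to `G`. -/
lemma weaklyConstructible_ofRep_obj (V : 𝒮.RepStrata R) :
    𝒮.weaklyConstructible ((𝒮.ofRep R).obj V) := by
  intro S₀ hS₀
  let S : 𝒮.Vertex := ⟨S₀, hS₀⟩
  -- The star of `S` contains `S`, so its preimage is the whole stratum, over which the constant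
  -- sheaf functor is left adjoint to sections.
  have hT : IsTerminal ((Opens.map (𝒮.incl S)).obj (𝒮.star S)) :=
    IsTerminal.ofUniqueHom (fun _ ↦ homOfLE fun x _ ↦ 𝒮.mem_star x.2)
      fun _ _ ↦ Subsingleton.elim _ _
  let adj := constantSheafAdj (Opens.grothendieckTopology (TopCat.of S₀)) (ModuleCat.{u} R) hT
  let adj' := TopCat.Sheaf.pullbackPushforwardAdjunction (ModuleCat.{u} R) (𝒮.incl S)
  let β (G : Sh R (TopCat.of S₀))
      (f : (TopCat.Sheaf.pullback (ModuleCat.{u} R) (𝒮.incl S)).obj ((𝒮.ofRep R).obj V) ⟶ G) :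
      (constantSheaf _ _).obj ((𝒮.repStalk S).obj V) ⟶ G :=
    (adj.homEquiv _ G).symm (𝒮.sectionsOfHom V S (adj'.homEquiv _ G f))
  have hβ (G : Sh R (TopCat.of S₀)) : Function.Bijective (β G) :=
    (adj.homEquiv _ G).symm.bijective.comp
      (((𝒮.isSupportedBelow_pushforward S G).bijective_sectionsOfHom V).comp
        (adj'.homEquiv _ G).bijective)
  -- Naturality in `G`: the bijection is composition with the image of the identity, which is
  -- therefore an isomorphism.
  have hβ' (G : Sh R (TopCat.of S₀)) (f) : β G f = β _ (𝟙 _) ≫ f := by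
    have e : adj'.homEquiv _ G f =
        adj'.homEquiv _ _ (𝟙 _) ≫ (TopCat.Sheaf.pushforward _ (𝒮.incl S)).map f := by
      rw [← adj'.homEquiv_naturality_right, Category.id_comp]
    have e' := (congr_arg (𝒮.sectionsOfHom V S) e).trans (𝒮.sectionsOfHom_comp V S _ _)
    exact (congr_arg (adj.homEquiv _ G).symm e').trans (adj.homEquiv_naturality_right_symm _ _)
  have : IsIso (β _ (𝟙 _)) :=
    isIso_of_coyoneda_map_bijective _ fun G ↦ (funext (hβ' G) : β G = _) ▸ hβ G
  exact Sheaf.isConstant_of_iso _ (asIso (β _ (𝟙 _))).symm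

end
end Stratification

/-! ### Corepresenting elements -/

/-- The element `e` of `G.obj E` corepresents the functor `G` to modules. -/
def Corepresents {C : Type*} [Category* C] {R : Type u} [CommRing R] (G : C ⥤ ModuleCat.{u} R)
    {E : C} (e : G.obj E) : Prop :=
  ∀ F : C, Function.Bijective fun f : E ⟶ F ↦ (G.map f).hom e

lemma Corepresents.projective {C : Type*} [Category* C] {R : Type u} [CommRing R]
    {G : C ⥤ ModuleCat.{u} R} [G.PreservesEpimorphisms] {E : C} {e : G.obj E}
    (he : Corepresents G e) : Projective E where
  factors {V W} f g _ := by
    obtain ⟨v, hv⟩ := (ModuleCat.epi_iff_surjective _).1 (G.map_epi g)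
      ((G.map f).hom e)
    obtain ⟨h, hh⟩ := (he V).2 v
    refine ⟨h, (he W).1 ?_⟩
    dsimp at hh ⊢
    rw [Functor.map_comp, ModuleCat.comp_apply]
    exact (congr_arg (G.map g).hom hh).trans hv

/-! ### Projective representations attached to strata -/

namespace Stratification

open SheafMod QuiverRep

variable {X : TopCat.{u}} (𝒮 : Stratification X)

section

variable (R : Type u) [CommRing R]

/-- The type-valued functor that is a point on the strata whose closure contains `S`. -/
def above (S : Paths 𝒮.Vertex) : Paths 𝒮.Vertex ⥤ Type u where
  obj T := ULift.{u} (PLift (S.1 ⊆ closure T.1))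
  map p := TypeCat.ofHom fun h ↦
    ⟨⟨h.down.down.trans (closure_minimal (𝒮.subset_closure_of_path p) isClosed_closure)⟩⟩

instance (S T : Paths 𝒮.Vertex) : Subsingleton ((𝒮.above S).obj T) :=
  inferInstanceAs (Subsingleton (ULift (PLift (S.1 ⊆ closure T.1))))

lemma above_map_eq (S : Paths 𝒮.Vertex) {T U : Paths 𝒮.Vertex} (p q : T ⟶ U) :
    (𝒮.above S).map p = (𝒮.above S).map q := by
  ext
  exact Subsingleton.elim (α := (𝒮.above S).obj U) _ _

/-- The projective representation attached to the stratum `S`. -/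
def projRep (S : Paths 𝒮.Vertex) : 𝒮.RepStrata R where
  obj := 𝒮.above S ⋙ ModuleCat.free R
  property := by
    rintro _ ⟨T, U, p, q, rfl⟩
    simp only [actRelation]
    rw [Finsupp.sum_sub_index (by intros; rw [sub_smul])]
    simp [𝒮.above_map_eq S p q]

/-- The generator of `projRep`. -/
def projRepGen (S : Paths 𝒮.Vertex) : (stalk _ S).obj (𝒮.projRep R S) :=
  ModuleCat.freeMk (R := R) (X := (𝒮.above S).obj S) ⟨⟨subset_closure⟩⟩

/-- The morphism from `projRep` given by an element of a stalk. -/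
def projRepDesc {S : Paths 𝒮.Vertex} (V : 𝒮.RepStrata R) (v : V.obj.obj S) :
    𝒮.projRep R S ⟶ V where
  hom :=
    { app T := ModuleCat.freeDesc (TypeCat.ofHom fun h : (𝒮.above S).obj T ↦
        (V.obj.map (𝒮.path h.down.down)).hom v)
      naturality T U p := by
        refine ModuleCat.free_hom_ext fun h ↦ ?_
        simp [projRep, ← RepStrata.map_eq 𝒮 V (𝒮.path h.down.down ≫ p)] }

lemma projRep_map_gen {S T : Paths 𝒮.Vertex} (h : (𝒮.above S).obj T) :
    ((𝒮.projRep R S).obj.map (𝒮.path h.down.down)).hom (𝒮.projRepGen R S) =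
      ModuleCat.freeMk (R := R) h :=
  (ModuleCat.free_map_apply ((𝒮.above S).map (𝒮.path h.down.down)) _).trans
    (congr_arg _ (Subsingleton.elim (α := (𝒮.above S).obj T) _ _))

lemma projRep_hom_apply {S T : Paths 𝒮.Vertex} {V : 𝒮.RepStrata R} (f : 𝒮.projRep R S ⟶ V)
    (h : (𝒮.above S).obj T) :
    (f.hom.app T).hom (ModuleCat.freeMk (R := R) h) =
      (V.obj.map (𝒮.path h.down.down)).hom ((f.hom.app S).hom (𝒮.projRepGen R S)) := by
  rw [← projRep_map_gen]
  exact ConcreteCategory.congr_hom (f.hom.naturality (𝒮.path h.down.down)) (𝒮.projRepGen R S)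

lemma projRepDesc_gen {S : Paths 𝒮.Vertex} (V : 𝒮.RepStrata R) (v : V.obj.obj S) :
    ((𝒮.projRepDesc R V v).hom.app S).hom (𝒮.projRepGen R S) = v := by
  have h : (V.obj.map (𝒮.path (S := S) (T := S) subset_closure)).hom v = v := by
    rw [RepStrata.map_eq 𝒮 V _ (𝟙 S), V.obj.map_id]
    rfl
  exact (ModuleCat.freeDesc_apply (R := R) (X := (𝒮.above S).obj S)
    (M := V.obj.obj S) _ _).trans h

/-- Yoneda for the preorder of strata: `projRep` is the free module on the functor represented by
`S`. -/
lemma corepresents_stalk (S : Paths 𝒮.Vertex) :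
    Corepresents (stalk (𝒮.relations R) S) (𝒮.projRepGen R S) := by
  intro V
  constructor
  · intro f g hfg
    ext T : 3
    refine ModuleCat.free_hom_ext (R := R) (X := (𝒮.above S).obj T) fun h ↦ ?_
    exact (𝒮.projRep_hom_apply R f h).trans
      ((congr_arg (V.obj.map (𝒮.path h.down.down)).hom hfg).trans
        (𝒮.projRep_hom_apply R g h).symm)
  · intro v
    refine ⟨𝒮.projRepDesc R V v, ?_⟩
    exact 𝒮.projRepDesc_gen R V v

lemma corepresents_repStalk (S : 𝒮.Vertex) :
    Corepresents (𝒮.repStalk S) (E := 𝒮.projRep R S) (𝒮.projRepGen R S) :=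
  𝒮.corepresents_stalk R S

instance (S : 𝒮.Vertex) : Projective (𝒮.projRep R S) :=
  (𝒮.corepresents_repStalk R S).projective

/-- Sections on the star are the stalk at `S` of `toRep F`, so the adjunction transports the
corepresenting object `projRep` to sheaves. This allows cohomology on stars to be treated as Ext. -/
lemma exists_corepresents_sections (S : 𝒮.Vertex) :
    ∃ (E : Sh R X) (e : (sections R (𝒮.star S)).obj E),
      Corepresents (sections R (𝒮.star S)) e := by
  refine ⟨(𝒮.ofRep R).obj (𝒮.projRep R S), ((𝒮.repStalk S).map
    ((𝒮.repAdjunction R).unit.app (𝒮.projRep R S)) ≫ (𝒮.toRepCompStalkIso S).hom.app _).hom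
      (𝒮.projRepGen R S), fun F ↦ ?_⟩
  have h := (𝒮.corepresents_repStalk R S ((𝒮.toRep R).obj F)).comp
    ((𝒮.repAdjunction R).homEquiv (𝒮.projRep R S) F).bijective
  convert! h using 1

/-! ### Projective objects in the category of representations with finitely generated stalks -/

lemma finiteStalks_projRep (S : Paths 𝒮.Vertex) :
    finiteStalks (𝒮.relations R) (𝒮.projRep R S) := fun T ↦ by
  have : Finite ((𝒮.above S).obj T) := Finite.of_subsingleton
  exact inferInstanceAs (Module.Finite R ((𝒮.above S).obj T →₀ R))

/-- The object of `RepStrataFin` given by `projRep`. -/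
abbrev projRepFin (S : Paths 𝒮.Vertex) : 𝒮.RepStrataFin R :=
  ⟨𝒮.projRep R S, 𝒮.finiteStalks_projRep R S⟩

variable [IsNoetherianRing R]

/-- There are finitely many strata and each stalk has a finite generating set; one projective is
taken per generator. Finiteness of `J` keeps the coproduct inside Rep_f. -/
lemma exists_epi_sigma_projRepFin (M : 𝒮.RepStrataFin R) :
    ∃ (J : Type u) (_ : Finite J) (S : J → 𝒮.Vertex)
      (f : (∐ fun j ↦ 𝒮.projRepFin R (S j)) ⟶ M), Epi f := by
  have hM (S : 𝒮.Vertex) : ∃ (s : Finset ((𝒮.repStalk S).obj M.obj)),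
      Submodule.span R (s : Set ((𝒮.repStalk S).obj M.obj)) = ⊤ :=
    (M.property S).fg_top
  choose s hs using hM
  let f (j : Σ S : 𝒮.Vertex, s S) : 𝒮.projRepFin R j.1 ⟶ M := ⟨𝒮.projRepDesc R M.obj j.2.1⟩
  refine ⟨Σ S : 𝒮.Vertex, s S, inferInstance, fun j ↦ j.1, Sigma.desc f, ?_⟩
  apply (finiteStalks (𝒮.relations R)).ι.epi_of_epi_map
  apply (satisfies (𝒮.relations R)).ι.epi_of_epi_map
  rw [NatTrans.epi_iff_epi_app]
  intro S
  rw [ModuleCat.epi_iff_surjective]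
  let φ : (𝒮.repStalk S).obj (∐ fun j : Σ S : 𝒮.Vertex, s S ↦ 𝒮.projRepFin R j.1).obj ⟶
    (𝒮.repStalk S).obj M.obj := (𝒮.repStalk S).map (Sigma.desc f).hom
  suffices LinearMap.range φ.hom = ⊤ from LinearMap.range_eq_top.1 this
  rw [eq_top_iff, ← hs S, Submodule.span_le]
  intro v hv
  let j : Σ S : 𝒮.Vertex, s S := ⟨S, ⟨v, hv⟩⟩
  have e : (Sigma.ι (fun j : Σ S : 𝒮.Vertex, s S ↦ 𝒮.projRepFin R j.1) j ≫ Sigma.desc f).hom =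
    𝒮.projRepDesc R M.obj v := congr_arg _ (Sigma.ι_desc f j)
  refine ⟨((𝒮.repStalk S).map (Sigma.ι (fun j : Σ S : 𝒮.Vertex, s S ↦
    𝒮.projRepFin R j.1) j).hom).hom (𝒮.projRepGen R S), ?_⟩
  have e' := ConcreteCategory.congr_hom ((𝒮.repStalk S).map_comp
    (Sigma.ι (fun j : Σ S : 𝒮.Vertex, s S ↦ 𝒮.projRepFin R j.1) j).hom (Sigma.desc f).hom)
      (𝒮.projRepGen R S)
  refine e'.symm.trans ?_
  refine (congr_arg (fun g ↦ ((𝒮.repStalk S).map g).hom (𝒮.projRepGen R S)) e).trans ?_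
  exact 𝒮.projRepDesc_gen R M.obj v

instance (S : 𝒮.Vertex) : Projective (𝒮.projRepFin R S) where
  factors {V W} f g _ := by
    have : Epi g.hom := inferInstanceAs (Epi ((finiteStalks (𝒮.relations R)).ι.map g))
    exact ⟨⟨Projective.factorThru f.hom g.hom⟩,
      InducedCategory.hom_ext (Projective.factorThru_comp f.hom g.hom)⟩

instance : EnoughProjectives (𝒮.RepStrataFin R) where
  presentation M := by
    obtain ⟨J, _, S, f, _⟩ := 𝒮.exists_epi_sigma_projRepFin R M
    exact ⟨{ p := _, f := f }⟩

/-- A projective is a retract of a finite coproduct of objects `projRepFin`, and the exact inclusion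
preserves finite coproducts. -/
instance : (finiteStalks (𝒮.relations R)).ι.PreservesProjectiveObjects where
  projective_obj {P} hP := by
    obtain ⟨J, _, S, f, _⟩ := 𝒮.exists_epi_sigma_projRepFin R P
    let ι := (finiteStalks (𝒮.relations R)).ι
    have (j : J) : Projective (ι.obj (𝒮.projRepFin R (S j))) :=
      inferInstanceAs (Projective (𝒮.projRep R (S j)))
    have : PreservesColimit (Discrete.functor fun j ↦ 𝒮.projRepFin R (S j)) ι :=
      (inferInstance : PreservesColimitsOfShape (Discrete J) ι).preservesColimit
    have : Projective (ι.obj (∐ fun j ↦ 𝒮.projRepFin R (S j))) :=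
      Projective.of_iso (PreservesCoproduct.iso ι _).symm inferInstance
    let r : Retract P (∐ fun j ↦ 𝒮.projRepFin R (S j)) :=
      ⟨Projective.factorThru (𝟙 P) f, f, Projective.factorThru_comp _ _⟩
    exact (r.map ι).projective

end
end Stratification

/-! ### Acyclicity with respect to a corepresentable functor -/

section

universe w v u'

open CategoryTheory.Abelian

variable {A : Type u'} [Category.{v} A] [Abelian A]

section

variable [HasExt.{w} A]

/-- An object without higher extensions by `E`. -/
def ExtAcyclic (E F : A) : Prop := ∀ n : ℕ, Subsingleton (Ext E F (n + 1))

lemma ExtAcyclic.of_injective (E F : A) [Injective F] : ExtAcyclic E F :=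
  fun n ↦ Ext.subsingleton_of_injective E F n

lemma ExtAcyclic.of_isZero (E : A) {F : A} (hF : IsZero F) : ExtAcyclic E F :=
  have := hF.injective
  .of_injective E F

variable {E : A} {S : ShortComplex A}

lemma ExtAcyclic.X₂ (hS : S.ShortExact) (h₁ : ExtAcyclic E S.X₁) (h₃ : ExtAcyclic E S.X₃) :
    ExtAcyclic E S.X₂ := fun n ↦ ⟨fun x y ↦ by
  have := h₁ n
  have := h₃ n
  obtain ⟨z, hz⟩ := Ext.covariant_sequence_exact₂ _ hS (x - y) (Subsingleton.elim _ _)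
  rw [Subsingleton.elim z 0, Ext.zero_comp] at hz
  exact sub_eq_zero.1 hz.symm⟩

lemma ExtAcyclic.X₃ (hS : S.ShortExact) (h₁ : ExtAcyclic E S.X₁) (h₂ : ExtAcyclic E S.X₂) :
    ExtAcyclic E S.X₃ := fun n ↦ ⟨fun x y ↦ by
  have := h₁ (n + 1)
  have := h₂ n
  obtain ⟨z, hz⟩ := Ext.covariant_sequence_exact₃ _ hS (x - y) rfl (Subsingleton.elim _ _)
  rw [Subsingleton.elim z 0, Ext.zero_comp] at hz
  exact sub_eq_zero.1 hz.symm⟩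

lemma ExtAcyclic.exists_lift (hS : S.ShortExact) (h₁ : ExtAcyclic E S.X₁) (f : E ⟶ S.X₃) :
    ∃ g : E ⟶ S.X₂, g ≫ S.g = f := by
  have := h₁ 0
  obtain ⟨z, hz⟩ := Ext.covariant_sequence_exact₃ _ hS (Ext.mk₀ f) rfl (Subsingleton.elim _ _)
  obtain ⟨g, rfl⟩ := Ext.homEquiv₀.symm.surjective z
  exact ⟨g, Ext.homEquiv₀.symm.injective (by simpa using hz)⟩

end

section

variable (K : CochainComplex A ℤ) (n : ℤ)

/-- The short exact sequence of boundaries, cycles and homology. -/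
def boundariesCycles : ShortComplex A :=
  ShortComplex.mk (kernel.ι (K.homologyπ n)) (K.homologyπ n) (kernel.condition _)

lemma boundariesCycles_shortExact : (boundariesCycles K n).ShortExact :=
  { exact := ShortComplex.exact_kernel _
    mono_f := inferInstanceAs (Mono (kernel.ι (K.homologyπ n)))
    epi_g := inferInstanceAs (Epi (K.homologyπ n)) }

/-- The short exact sequence of cycles, cochains and boundaries. -/
def cyclesBoundaries (i n : ℤ) : ShortComplex A :=
  ShortComplex.mk (K.iCycles i) (kernel.lift (K.homologyπ n) (K.toCycles i n) (by simp))
    (by simp [← cancel_mono (kernel.ι _), ← cancel_mono (K.iCycles n)])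

lemma cyclesBoundaries_shortExact (i n : ℤ) (hi : (ComplexShape.up ℤ).prev n = i) :
    (cyclesBoundaries K i n).ShortExact := by
  have hi' : (ComplexShape.up ℤ).next i = n := by simp [← hi]
  have h : (ShortComplex.mk (K.toCycles i n) (K.homologyπ n) (by simp)).Exact :=
    ShortComplex.exact_of_g_is_cokernel _ (K.homologyIsCokernel i n hi)
  have : Epi (kernel.lift (K.homologyπ n) (K.toCycles i n) (by simp)) :=
    h.epi_kernelLift
  have h' : (ShortComplex.mk (K.iCycles i) (K.d i n) (by simp)).Exact :=
    ShortComplex.exact_of_f_is_kernel _ (K.cyclesIsKernel i n hi')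
  refine { exact := ?_
           mono_f := inferInstanceAs (Mono (K.iCycles _))
           epi_g := this }
  let φ : cyclesBoundaries K i n ⟶ ShortComplex.mk (K.iCycles i) (K.d i n) (by simp) :=
    { τ₁ := 𝟙 _
      τ₂ := 𝟙 _
      τ₃ := kernel.ι _ ≫ K.iCycles n
      comm₁₂ := by simp [cyclesBoundaries]
      comm₂₃ := by simp [cyclesBoundaries] }
  have : Epi φ.τ₁ := inferInstanceAs (Epi (𝟙 _))
  have : IsIso φ.τ₂ := inferInstanceAs (IsIso (𝟙 _))
  have : Mono φ.τ₃ := inferInstanceAs (Mono (kernel.ι _ ≫ K.iCycles n))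
  exact (ShortComplex.exact_iff_of_epi_of_isIso_of_mono φ).2 h'

variable {K} [HasExt.{w} A] {E : A}

/-- Induction on the degree from the lower bound. Cycles and cochains in degree n - 1 give the
boundaries in degree n (`X₃`); with the homology these give the cycles in degree n (`X₂`). -/
lemma extAcyclic_cycles (hK : CochainComplex.plus A K) (hX : ∀ n, ExtAcyclic E (K.X n))
    (hH : ∀ n, ExtAcyclic E (K.homology n)) : ExtAcyclic E (K.cycles n) := by
  obtain ⟨a, ha⟩ := hK
  by_cases hn : n < a
  · exact .of_isZero _ (((K.isZero_of_isStrictlyGE a n hn)).of_mono (K.iCycles n))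
  · obtain ⟨k, rfl⟩ := Int.le.dest (not_lt.1 hn)
    have step (n : ℤ) (h : ExtAcyclic E (K.cycles (n - 1))) : ExtAcyclic E (K.cycles n) :=
      .X₂ (boundariesCycles_shortExact K n)
        (.X₃ (cyclesBoundaries_shortExact K (n - 1) n (by simp)) h (hX _)) (hH n)
    clear hn
    induction k with
    | zero =>
      refine step _ (.of_isZero _ ?_)
      exact (K.isZero_of_isStrictlyGE a _ (by simp)).of_mono (K.iCycles _)
    | succ k ih =>
      refine step _ ?_
      convert ih using 2
      push_cast
      ring

lemma extAcyclic_boundaries (hK : CochainComplex.plus A K) (hX : ∀ n, ExtAcyclic E (K.X n))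
    (hH : ∀ n, ExtAcyclic E (K.homology n)) : ExtAcyclic E (boundariesCycles K n).X₁ :=
  .X₃ (cyclesBoundaries_shortExact K (n - 1) n (by simp)) (extAcyclic_cycles _ hK hX hH) (hX _)

end

end

section

universe w v u'

open CategoryTheory.Abelian

variable {A : Type u'} [Category.{v} A] [Abelian A] [HasExt.{w} A] {R : Type u} [CommRing R]
  {G : A ⥤ ModuleCat.{u} R} [G.Additive] {E : A} {e : G.obj E}

/-- Applying `G` to an injective resolution is applying Hom(E, -), so the derived functors of `G`
are the groups Ext(E, -). -/
lemma Corepresents.extAcyclic (he : Corepresents G e) [EnoughInjectives A] {F : A}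
    (hF : ∀ i > 0, IsZero ((G.rightDerived i).obj F)) : ExtAcyclic E F := by
  intro n
  obtain ⟨I⟩ : Nonempty (InjectiveResolution F) := HasInjectiveResolution.out
  suffices ∀ x : Ext E F (n + 1), x = 0 from ⟨fun x y ↦ (this x).trans (this y).symm⟩
  intro x
  obtain ⟨f, hf, rfl⟩ := I.extMk_surjective x (n + 2) rfl
  rw [I.extMk_eq_zero_iff _ _ _ _ n rfl]
  have h : (((G.mapHomologicalComplex _).obj I.cocomplex).sc' n (n + 1) (n + 2)).Exact := by
    rw [← HomologicalComplex.exactAt_iff' _ n (n + 1) (n + 2) (by simp) (by simp),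
      HomologicalComplex.exactAt_iff_isZero_homology]
    exact (hF (n + 1) (by simp)).of_iso (I.isoRightDerivedObj G (n + 1)).symm
  rw [ShortComplex.moduleCat_exact_iff] at h
  -- The cocycle `f` representing the class becomes a cycle, hence a boundary; the element `z`
  -- bounding it comes from a map out of `E`.
  obtain ⟨z, hz⟩ := h ((G.map f).hom e) (by
    have := ConcreteCategory.congr_hom (G.map_comp f (I.cocomplex.d (n + 1) (n + 2))) e
    rw [hf, G.map_zero] at this
    exact this.symm)
  obtain ⟨g, rfl⟩ := (he _).2 z
  refine ⟨g, (he _).1 ?_⟩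
  dsimp
  rw [Functor.map_comp]
  exact hz

/-- `G` preserves the homology of a bounded below complex if it is acyclic on the terms and the
homology of the complex. -/
lemma Corepresents.preservesLeftHomologyOf (he : Corepresents G e) [PreservesFiniteLimits G]
    {K : CochainComplex A ℤ}
    (hK : CochainComplex.plus A K) (hX : ∀ n, ExtAcyclic E (K.X n))
    (hH : ∀ n, ExtAcyclic E (K.homology n)) (n : ℤ) :
    G.PreservesLeftHomologyOf (K.sc n) := by
  let h : (K.sc n).LeftHomologyData :=
    { K := K.cycles n
      H := K.homology n
      i := K.iCycles n
      π := K.homologyπ n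
      wi := (K.sc n).iCycles_g
      hi := (K.sc n).cyclesIsKernel
      wπ := (K.sc n).toCycles_comp_homologyπ
      hπ := (K.sc n).homologyIsCokernel }
  have hf' : h.f' = K.toCycles _ n := rfl
  -- A map from `E` killed in homology lands in the boundaries, and lifts to cochains because the
  -- cycles one degree lower have no Ext¹ from `E`.
  have hG : (ShortComplex.mk (G.map (K.toCycles ((ComplexShape.up ℤ).prev n) n))
      (G.map (K.homologyπ n)) (by rw [← G.map_comp]; simp)).Exact := by
    rw [ShortComplex.moduleCat_exact_iff]
    intro z hz
    obtain ⟨g, rfl⟩ := (he _).2 z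
    have hg : g ≫ K.homologyπ n = 0 := (he _).1 (by
      dsimp at hz ⊢
      rw [G.map_comp, G.map_zero]
      exact hz)
    obtain ⟨k : E ⟶ K.X _, hk⟩ := ExtAcyclic.exists_lift
      (cyclesBoundaries_shortExact K _ n rfl) (extAcyclic_cycles _ hK hX hH) (kernel.lift _ g hg)
    refine ⟨(G.map k).hom e, ?_⟩
    have hk' : k ≫ K.toCycles _ n = g := by
      have hk' : k ≫ kernel.lift (K.homologyπ n) (K.toCycles _ n) (by simp) =
        kernel.lift _ g hg := hk
      rw [← kernel.lift_ι (K.homologyπ n) g hg, ← hk', Category.assoc, kernel.lift_ι]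
    have := ConcreteCategory.congr_hom (G.map_comp k (K.toCycles _ n)) e
    rw [hk'] at this
    exact this.symm
  -- A map from `E` to the homology lifts to the cycles because the boundaries have no Ext¹ from
  -- `E`.
  have hG' : Epi (G.map (K.homologyπ n)) := by
    rw [ModuleCat.epi_iff_surjective]
    intro z
    obtain ⟨g, rfl⟩ := (he _).2 z
    obtain ⟨k, hk⟩ := ExtAcyclic.exists_lift (boundariesCycles_shortExact K n)
      (extAcyclic_boundaries _ hK hX hH) g
    refine ⟨(G.map k).hom e, ?_⟩
    have := ConcreteCategory.congr_hom (G.map_comp k (K.homologyπ n)) e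
    rw [show k ≫ K.homologyπ n = g from hk] at this
    exact this.symm
  have : h.IsPreservedBy G :=
    { g := inferInstance
      f' := preservesColimit_of_preserves_colimit_cocone h.hπ
        ((CokernelCofork.isColimitMapCoconeEquiv _ G).symm hG.gIsCokernel) }
  exact Functor.PreservesLeftHomologyOf.mk' G h

end

/-! ### Homology and natural transformations; unit and counit on complexes -/

section

variable {C D : Type*} [Category* C] [Category* D] [Abelian C] [Abelian D]

/-- Since `F` and `G` commute with the homology of `S`, the induced map on homology is `τ` at that
homology. -/
lemma CategoryTheory.NatTrans.isIso_homologyMap_mapNatTrans {F G : C ⥤ D}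
    [F.PreservesZeroMorphisms] [G.PreservesZeroMorphisms] (τ : F ⟶ G) (S : ShortComplex C)
    [F.PreservesLeftHomologyOf S] [G.PreservesLeftHomologyOf S] [IsIso (τ.app S.homology)] :
    IsIso (ShortComplex.homologyMap (S.mapNatTrans τ)) := by
  rw [(ShortComplex.LeftHomologyMapData.natTransApp S.homologyData.left τ).homologyMap_eq]
  have : IsIso (ShortComplex.LeftHomologyMapData.natTransApp S.homologyData.left τ).φH :=
    inferInstanceAs (IsIso (τ.app S.homology))
  infer_instance

lemma CategoryTheory.Functor.isIso_map_homologyMap_iff (F : C ⥤ D) [F.PreservesZeroMorphisms]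
    [F.PreservesHomology] {S T : ShortComplex C} (φ : S ⟶ T) :
    IsIso (F.map (ShortComplex.homologyMap φ)) ↔
      IsIso (ShortComplex.homologyMap (F.mapShortComplex.map φ)) :=
  (MorphismProperty.isomorphisms D).arrow_mk_iso_iff
    (Arrow.isoMk (S.mapHomologyIso F).symm (T.mapHomologyIso F).symm
      (by simpa using! (ShortComplex.mapHomologyIso_inv_naturality φ F).symm))

lemma CategoryTheory.Functor.preservesLeftHomologyOf_of_iso {F G : C ⥤ D}
    [F.PreservesZeroMorphisms] [G.PreservesZeroMorphisms] (e : F ≅ G) (S : ShortComplex C)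
    [F.PreservesLeftHomologyOf S] : G.PreservesLeftHomologyOf S where
  isPreservedBy h :=
    have := Functor.PreservesLeftHomologyOf.isPreservedBy (F := F) h
    { g :=
        have := this.g
        preservesLimit_of_natIso _ e
      f' :=
        have := this.f'
        preservesColimit_of_natIso _ e }

variable {L : C ⥤ D} {G : D ⥤ C} [L.Additive] [G.Additive] (adj : L ⊣ G)

/-- The counit of an adjunction, on cochain complexes. -/
def CategoryTheory.Adjunction.counitCochain (K : CochainComplex D ℤ) :
    (L.mapHomologicalComplex _).obj ((G.mapHomologicalComplex _).obj K) ⟶ K where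
  f n := adj.counit.app (K.X n)
  comm' _ _ _ := (adj.counit.naturality _).symm

/-- The unit of an adjunction, on cochain complexes. -/
def CategoryTheory.Adjunction.unitCochain (K : CochainComplex C ℤ) :
    K ⟶ (G.mapHomologicalComplex _).obj ((L.mapHomologicalComplex _).obj K) where
  f n := adj.unit.app (K.X n)
  comm' _ _ _ := (adj.unit.naturality _).symm

end

/-! ### The counit on complexes of injective sheaves -/

namespace Stratification

open SheafMod QuiverRep

variable {X : TopCat.{u}} {𝒮 : Stratification X} {R : Type u} [CommRing R]

instance (S : 𝒮.Vertex) : PreservesFiniteLimits (sections R (𝒮.star S)) :=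
  have : PreservesFiniteLimits (𝒮.toRep R) :=
    have := (𝒮.repAdjunction R).rightAdjoint_preservesLimits
    inferInstance
  preservesFiniteLimits_of_natIso (𝒮.toRepCompStalkIso S)

/-- On the stalk at a point of `S` the source is Γ(star S, K). Injectives and the cohomology sheaves
of `K` are acyclic on the star, so the cohomology there is Γ(star S, Hⁿ K), and the claim reduces to
the counit at Hⁿ K. -/
lemma IsAcyclic.quasiIso_counitCochain (h𝒮 : 𝒮.IsAcyclic R) (K : CochainComplex (Sh R X) ℤ)
    (hK : CochainComplex.plus _ K) (hX : ∀ n, Injective (K.X n))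
    (hH : ∀ n, 𝒮.weaklyConstructible (K.homology n)) :
    QuasiIso ((𝒮.repAdjunction R).counitCochain K) where
  quasiIsoAt n := by
    have := hasExt_of_enoughInjectives.{u} (Sh R X)
    rw [quasiIsoAt_iff_isIso_homologyMap]
    refine isIso_of_isIso_stalkAt_map _ fun x ↦ ?_
    refine (Functor.isIso_map_homologyMap_iff (stalkAt (R := R) x) _).2 ?_
    let τ := Functor.whiskerRight (𝒮.repAdjunction R).counit (stalkAt (R := R) x)
    have : IsIso (τ.app (K.sc n).homology) := by
      have := h𝒮.isIso_counit_app _ (hH n)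
      exact inferInstanceAs (IsIso ((stalkAt x).map
        ((𝒮.repAdjunction R).counit.app (K.homology n))))
    obtain ⟨S, hx⟩ := 𝒮.exists_vertex_mem x
    obtain ⟨E, e, he⟩ := 𝒮.exists_corepresents_sections R S
    have : (sections R (𝒮.star S)).PreservesLeftHomologyOf (K.sc n) :=
      he.preservesLeftHomologyOf hK (fun n ↦ .of_injective E (K.X n))
        (fun n ↦ he.extAcyclic (h𝒮.isZero_cohomology _ (hH n) S)) n
    have : ((𝒮.toRep R ⋙ 𝒮.ofRep R) ⋙ stalkAt (R := R) x).PreservesLeftHomologyOf (K.sc n) :=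
      Functor.preservesLeftHomologyOf_of_iso ((𝒮.toRepCompStalkIso S).symm ≪≫
        Functor.isoWhiskerLeft (𝒮.toRep R) (asIso (𝒮.toStalk S x hx)) ≪≫
          (Functor.associator _ _ _).symm) _
    have : (𝟭 (Sh R X) ⋙ stalkAt (R := R) x).PreservesLeftHomologyOf (K.sc n) := inferInstance
    exact τ.isIso_homologyMap_mapNatTrans (K.sc n)

end Stratification

/-! ### Formal consequences of an invertible counit -/

section

variable {A B : Type*} [Category* A] [Category* B] [Abelian A] [Abelian B]
  {L : B ⥤ A} {G : A ⥤ B} [L.Additive] [G.Additive] (adj : L ⊣ G)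

namespace CategoryTheory.Adjunction

lemma counitCochain_naturality {K K' : CochainComplex A ℤ} (f : K ⟶ K') :
    (L.mapHomologicalComplex _).map ((G.mapHomologicalComplex _).map f) ≫ adj.counitCochain K' =
      adj.counitCochain K ≫ f := by
  ext n
  exact adj.counit.naturality (f.f n)

lemma unitCochain_naturality {K K' : CochainComplex B ℤ} (f : K ⟶ K') :
    adj.unitCochain K ≫ (G.mapHomologicalComplex _).map ((L.mapHomologicalComplex _).map f) =
      f ≫ adj.unitCochain K' := by
  ext n
  exact (adj.unit.naturality (f.f n)).symm

lemma unitCochain_map_counitCochain (K : CochainComplex A ℤ) :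
    adj.unitCochain ((G.mapHomologicalComplex _).obj K) ≫
      (G.mapHomologicalComplex _).map (adj.counitCochain K) = 𝟙 _ := by
  ext n
  exact adj.right_triangle_components (K.X n)

lemma map_unitCochain_counitCochain (K : CochainComplex B ℤ) :
    (L.mapHomologicalComplex _).map (adj.unitCochain K) ≫
      adj.counitCochain ((L.mapHomologicalComplex _).obj K) = 𝟙 _ := by
  ext n
  exact adj.left_triangle_components (K.X n)

end CategoryTheory.Adjunction

end

section

variable {A B : Type*} [Category* A] [Category* B] [Abelian A] [Abelian B]
  {L : B ⥤ A} {G : A ⥤ B} [L.Additive] [G.Additive] (adj : L ⊣ G)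

namespace DerivedCategory

variable [HasDerivedCategory A]

instance isIso_Qh_map_quotient_map {K K' : CochainComplex A ℤ} (f : K ⟶ K') [QuasiIso f] :
    IsIso (Qh.map ((HomotopyCategory.quotient A (.up ℤ)).map f)) :=
  (NatIso.isIso_map_iff (quotientCompQhIso A) f).2 inferInstance

end DerivedCategory

namespace CategoryTheory.Adjunction

/-- Applying `L` and then the counit gives back `i`; two out of three applies, and `L` reflects
quasi-isomorphisms. -/
lemma quasiIso_homEquiv_of_quasiIso_counitCochain [L.PreservesHomology] [L.ReflectsIsomorphisms]
    {V : CochainComplex B ℤ} {I : CochainComplex A ℤ}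
    (i : (L.mapHomologicalComplex _).obj V ⟶ I) [QuasiIso i] (hI : QuasiIso (adj.counitCochain I)) :
    QuasiIso (adj.unitCochain V ≫ (G.mapHomologicalComplex _).map i) := by
  have h : (L.mapHomologicalComplex _).map
      (adj.unitCochain V ≫ (G.mapHomologicalComplex _).map i) ≫ adj.counitCochain I = i := by
    rw [Functor.map_comp, Category.assoc, counitCochain_naturality, ← Category.assoc,
      map_unitCochain_counitCochain, Category.id_comp]
  have : QuasiIso ((L.mapHomologicalComplex _).map
      (adj.unitCochain V ≫ (G.mapHomologicalComplex _).map i)) := by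
    rw [← quasiIso_iff_comp_right _ (adj.counitCochain I), h]
    infer_instance
  exact (HomologicalComplex.quasiIso_map_iff_of_preservesHomology _ L).1 this

variable [HasDerivedCategory A] [HasDerivedCategory B]

open _root_.DerivedCategory HomotopyCategory in
-- Both targets are K-injective, so morphisms in the derived categories are homotopy classes. The
-- inverse sends `h` to `L h` followed by the counit at `I'`, descended along the counit at `I`, the
-- only one that has to be inverted.
lemma bijective_Qh_map_mapHomotopyCategory_map {I I' : CochainComplex A ℤ}
    [I'.IsKInjective] [CochainComplex.IsKInjective ((G.mapHomologicalComplex _).obj I')] (hI : QuasiIso (adj.counitCochain I)) :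
    Function.Bijective
      (fun f : (quotient A (.up ℤ)).obj I ⟶ (quotient A (.up ℤ)).obj I' ↦
        Qh.map ((G.mapHomotopyCategory (.up ℤ)).map f)) := by
  have injA {K : CochainComplex A ℤ} {f g : K ⟶ I'}
      (h : Qh.map ((quotient _ _).map f) = Qh.map ((quotient _ _).map g)) :
      (quotient _ _).map f = (quotient _ _).map g :=
    (CochainComplex.IsKInjective.Qh_map_bijective _ _).injective h
  constructor
  · intro f g h
    obtain ⟨f, rfl⟩ := (quotient _ _).map_surjective f
    obtain ⟨g, rfl⟩ := (quotient _ _).map_surjective g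
    replace h : (quotient _ _).map ((G.mapHomologicalComplex _).map f) =
      (quotient _ _).map ((G.mapHomologicalComplex _).map g) :=
        (CochainComplex.IsKInjective.Qh_map_bijective _ _).injective h
    have h' : (quotient _ _).map
        ((L.mapHomologicalComplex _).map ((G.mapHomologicalComplex _).map f)) =
          (quotient _ _).map
            ((L.mapHomologicalComplex _).map ((G.mapHomologicalComplex _).map g)) :=
      congr_arg (L.mapHomotopyCategory (.up ℤ)).map h
    apply injA
    rw [← cancel_epi (Qh.map ((quotient _ _).map (adj.counitCochain I))), ← Functor.map_comp,
      ← Functor.map_comp, ← Functor.map_comp, ← Functor.map_comp,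
      ← adj.counitCochain_naturality, ← adj.counitCochain_naturality, Functor.map_comp, h',
      ← Functor.map_comp]
  · intro h
    obtain ⟨h, rfl⟩ : ∃ h' : (G.mapHomologicalComplex (.up ℤ)).obj I ⟶
        (G.mapHomologicalComplex (.up ℤ)).obj I', Qh.map ((quotient _ _).map h') = h := by
      obtain ⟨h₁, hh⟩ := (CochainComplex.IsKInjective.Qh_map_bijective
        ((quotient _ _).obj ((G.mapHomologicalComplex (.up ℤ)).obj I))
        ((G.mapHomologicalComplex (.up ℤ)).obj I')).surjective h
      obtain ⟨h₂, rfl⟩ := (quotient _ _).map_surjective h₁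
      exact ⟨h₂, hh⟩
    obtain ⟨f, hf⟩ := (CochainComplex.IsKInjective.Qh_map_bijective _ _).surjective
      (inv (Qh.map ((quotient _ _).map (adj.counitCochain I))) ≫
        Qh.map ((quotient _ _).map ((L.mapHomologicalComplex _).map h ≫ adj.counitCochain I')))
    obtain ⟨f, rfl⟩ := (quotient _ _).map_surjective f
    rw [IsIso.eq_inv_comp, ← Functor.map_comp, ← Functor.map_comp] at hf
    have hf' : (quotient _ _).map ((G.mapHomologicalComplex _).map (adj.counitCochain I ≫ f)) =
        (quotient _ _).map ((G.mapHomologicalComplex _).map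
          ((L.mapHomologicalComplex _).map h ≫ adj.counitCochain I')) :=
      congr_arg (G.mapHomotopyCategory (.up ℤ)).map (injA hf)
    refine ⟨(quotient _ _).map f, congr_arg Qh.map ?_⟩
    change (quotient _ _).map ((G.mapHomologicalComplex _).map f) = (quotient _ _).map h
    -- After precomposition with the unit, the triangle identity turns one side into the image of
    -- `f`; naturality and the triangle identity turn the other into `h`.
    have := congr_arg (fun φ ↦ (quotient _ _).map (adj.unitCochain _) ≫ φ) hf'
    simp only [← Functor.map_comp (quotient _ _)] at this
    rwa [Functor.map_comp (G.mapHomologicalComplex _),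
      Functor.map_comp (G.mapHomologicalComplex _), ← Category.assoc, ← Category.assoc,
      adj.unitCochain_map_counitCochain, Category.id_comp, adj.unitCochain_naturality,
      Category.assoc, adj.unitCochain_map_counitCochain, Category.comp_id] at this

end CategoryTheory.Adjunction

end

/-! ### Derived functors of right adjoints of exact functors -/

lemma CategoryTheory.Functor.map_bijective_of_iso {C D : Type*} [Category* C] [Category* D]
    (F : C ⥤ D) {X Y X' Y' : C} (e : X ≅ X') (e' : Y ≅ Y')
    (h : Function.Bijective (F.map : (X ⟶ Y) → _)) :
    Function.Bijective (F.map : (X' ⟶ Y') → _) := by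
  have : (F.map : (X' ⟶ Y') → _) =
      ((F.mapIso e).homCongr (F.mapIso e')) ∘ F.map ∘ (e.homCongr e').symm := by
    ext f
    simp [Iso.homCongr]
  rw [this]
  exact (Equiv.bijective _).comp (h.comp (Equiv.bijective _))

lemma CategoryTheory.NatTrans.map_bijective_of_isIso {C D : Type*} [Category* C] [Category* D]
    {F G : C ⥤ D} (τ : F ⟶ G) {X Y : C} [IsIso (τ.app X)] [IsIso (τ.app Y)]
    (h : Function.Bijective (F.map : (X ⟶ Y) → _)) :
    Function.Bijective (G.map : (X ⟶ Y) → _) := by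
  have : (G.map : (X ⟶ Y) → _) = ((asIso (τ.app X)).homCongr (asIso (τ.app Y))) ∘ F.map := by
    ext f
    simp [Iso.homCongr]
  rw [this]
  exact (Equiv.bijective _).comp h

/-- An exact functor commutes with the cohomology of objects of the derived category. -/
def CategoryTheory.Functor.homologyMapDerivedCategoryIso {C D : Type*} [Category* C] [Category* D]
    [Abelian C] [Abelian D] [HasDerivedCategory C] [HasDerivedCategory D] (F : C ⥤ D) [F.Additive]
    [PreservesFiniteLimits F] [PreservesFiniteColimits F] (K : DerivedCategory C) (n : ℤ) :
    (DerivedCategory.homologyFunctor D n).obj (F.mapDerivedCategory.obj K) ≅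
      F.obj ((DerivedCategory.homologyFunctor C n).obj K) :=
  (DerivedCategory.homologyFunctor D n).mapIso
      (F.mapDerivedCategory.mapIso (DerivedCategory.Q.objObjPreimageIso K).symm ≪≫
        F.mapDerivedCategoryFactors.app _) ≪≫
    (DerivedCategory.homologyFunctorFactors D n).app _ ≪≫
    ((DerivedCategory.Q.objPreimage K).sc n).mapHomologyIso F ≪≫
    F.mapIso (((DerivedCategory.homologyFunctorFactors C n).app _).symm ≪≫
      (DerivedCategory.homologyFunctor C n).mapIso (DerivedCategory.Q.objObjPreimageIso K))

section

variable {A B : Type*} [Category* A] [Category* B] [Abelian A] [Abelian B]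
  [EnoughInjectives A] [HasDerivedCategory A]
  {L : B ⥤ A} {G : A ⥤ B} [L.Additive] [G.Additive] (adj : L ⊣ G)

/-- The image in the derived category of a bounded below complex of injective objects. -/
abbrev DerivedCategory.Plus.ofInjective (I : CochainComplex.Plus (InjectiveObject A)) :
    DerivedCategory.Plus A :=
  DerivedCategory.Plus.Q.obj ((InjectiveObject.ι A).mapCochainComplexPlus.obj I)

/-- The cohomology of the image in the derived category of a complex of injective objects. -/
def DerivedCategory.Plus.homologyOfInjectiveIso (I : CochainComplex.Plus (InjectiveObject A))
    (n : ℤ) :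
    (DerivedCategory.homologyFunctor A n).obj (DerivedCategory.Plus.ofInjective I).obj ≅
      HomologicalComplex.homology
        (((InjectiveObject.ι A).mapHomologicalComplex (.up ℤ)).obj I.obj) n :=
  (DerivedCategory.homologyFunctor A n).mapIso ((DerivedCategory.quotientCompQhIso A).app _) ≪≫
    (DerivedCategory.homologyFunctorFactors A n).app _

namespace CategoryTheory.Adjunction

variable {W : ObjectProperty A}

/-- The counit of the adjunction is a quasi-isomorphism for all bounded below complexes of
injective objects whose cohomology belongs to `W`. -/
def IsCounitResolving (W : ObjectProperty A) : Prop :=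
  ∀ K : CochainComplex A ℤ, CochainComplex.plus A K → (∀ n, Injective (K.X n)) →
    (∀ n, W (K.homology n)) → QuasiIso (adj.counitCochain K)

variable {adj} in
lemma IsCounitResolving.exists_ofInjective_iso [W.IsClosedUnderIsomorphisms]
    (h : adj.IsCounitResolving W) (K : DerivedCategory.Plus A)
    (hK : ∀ n, W ((DerivedCategory.homologyFunctor A n).obj K.obj)) :
    ∃ I : CochainComplex.Plus (InjectiveObject A),
      QuasiIso (adj.counitCochain
        (((InjectiveObject.ι A).mapHomologicalComplex (.up ℤ)).obj I.obj)) ∧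
      Nonempty (DerivedCategory.Plus.ofInjective I ≅ K) := by
  obtain ⟨n, hn⟩ := K.property
  have : K.IsGE n := (K.isGE_ι_obj_iff n).1 hn
  obtain ⟨I, _, ⟨e⟩⟩ := DerivedCategory.Plus.exists_injective_nonempty_iso K n
  refine ⟨I, h _ ⟨n, inferInstance⟩ (fun i ↦ (I.obj.X i).property) fun i ↦ ?_, ⟨e⟩⟩
  exact W.prop_of_iso ((DerivedCategory.homologyFunctor A i).mapIso
    (DerivedCategory.Plus.ι.mapIso e.symm) ≪≫ DerivedCategory.Plus.homologyOfInjectiveIso I i)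
    (hK i)

variable [HasDerivedCategory B]

variable (G) in
/-- The right derived functor on a bounded below complex of injective objects. -/
def rightDerivedOfInjectiveIso (I : CochainComplex.Plus (InjectiveObject A)) :
    (G.rightDerivedFunctorPlus.obj (DerivedCategory.Plus.ofInjective I)).obj ≅
      DerivedCategory.Q.obj ((G.mapHomologicalComplex (.up ℤ)).obj
        (((InjectiveObject.ι A).mapHomologicalComplex (.up ℤ)).obj I.obj)) :=
  DerivedCategory.Plus.ι.mapIso (asIso (G.rightDerivedFunctorPlusUnit.app
      ((HomotopyCategory.Plus.quotient A).obj
        ((InjectiveObject.ι A).mapCochainComplexPlus.obj I)))).symm ≪≫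
    (DerivedCategory.quotientCompQhIso B).app _

/-- On complexes of injectives the derived functor is `G` termwise, and `G` preserves injectives as
right adjoint of an exact functor, so the statement for homotopy classes applies. -/
lemma bijective_rightDerivedFunctorPlus_map_ofInjective [PreservesFiniteLimits L]
    [PreservesFiniteColimits L] (I I' : CochainComplex.Plus (InjectiveObject A))
    (hI : QuasiIso (adj.counitCochain
      (((InjectiveObject.ι A).mapHomologicalComplex (.up ℤ)).obj I.obj))) :
    Function.Bijective (G.rightDerivedFunctorPlus.map :
      (DerivedCategory.Plus.ofInjective I ⟶ DerivedCategory.Plus.ofInjective I') → _) := by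
  let K := ((InjectiveObject.ι A).mapHomologicalComplex (.up ℤ)).obj I.obj
  let K' := ((InjectiveObject.ι A).mapHomologicalComplex (.up ℤ)).obj I'.obj
  have : CochainComplex.IsKInjective ((G.mapHomologicalComplex (.up ℤ)).obj K') := by
    obtain ⟨n, hn⟩ := I'.property
    have : CochainComplex.IsStrictlyGE ((G.mapHomologicalComplex (.up ℤ)).obj K') n :=
      inferInstance
    have (i : ℤ) : Injective (((G.mapHomologicalComplex (.up ℤ)).obj K').X i) :=
      adj.map_injective _ (I'.obj.X i).property
    exact CochainComplex.isKInjective_of_injective _ n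
  have h₁ := adj.bijective_Qh_map_mapHomotopyCategory_map (I := K) (I' := K') hI
  have h₂ : Function.Bijective ((G.mapHomotopyCategoryPlus ⋙ DerivedCategory.Plus.Qh).map :
      ((HomotopyCategory.Plus.quotient A).obj ((InjectiveObject.ι A).mapCochainComplexPlus.obj I) ⟶
        (HomotopyCategory.Plus.quotient A).obj
          ((InjectiveObject.ι A).mapCochainComplexPlus.obj I')) → _) := by
    rw [← Function.Bijective.of_comp_iff'
      (DerivedCategory.TStructure.t.plus.fullyFaithfulι.map_bijective _ _)]
    exact h₁.comp ((HomotopyCategory.Plus.fullyFaithfulι A).map_bijective _ _)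
  have h₃ := NatTrans.map_bijective_of_isIso G.rightDerivedFunctorPlusUnit h₂
  have h₄ := DerivedCategory.Plus.Qh_map_bijective_of_isKInjective
    ((HomotopyCategory.Plus.quotient A).obj ((InjectiveObject.ι A).mapCochainComplexPlus.obj I))
    ((HomotopyCategory.Plus.quotient A).obj ((InjectiveObject.ι A).mapCochainComplexPlus.obj I'))
    (inferInstanceAs (CochainComplex.IsKInjective K'))
  exact (Function.Bijective.of_comp_iff _ h₄).1 h₃

variable {adj}

namespace IsCounitResolving

variable [W.IsClosedUnderIsomorphisms]

variable [PreservesFiniteLimits L] [PreservesFiniteColimits L]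

lemma bijective_map (h : adj.IsCounitResolving W) (K K' : DerivedCategory.Plus A)
    (hK : ∀ n, W ((DerivedCategory.homologyFunctor A n).obj K.obj))
    (hK' : ∀ n, W ((DerivedCategory.homologyFunctor A n).obj K'.obj)) :
    Function.Bijective (G.rightDerivedFunctorPlus.map : (K ⟶ K') → _) := by
  obtain ⟨I, hI, ⟨e⟩⟩ := h.exists_ofInjective_iso K hK
  obtain ⟨I', -, ⟨e'⟩⟩ := h.exists_ofInjective_iso K' hK'
  exact Functor.map_bijective_of_iso _ e e'
    (adj.bijective_rightDerivedFunctorPlus_map_ofInjective I I' hI)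

lemma nonempty_mapDerivedCategory_iso (h : adj.IsCounitResolving W) (K : DerivedCategory.Plus A)
    (hK : ∀ n, W ((DerivedCategory.homologyFunctor A n).obj K.obj)) :
    Nonempty (L.mapDerivedCategory.obj (G.rightDerivedFunctorPlus.obj K).obj ≅ K.obj) := by
  obtain ⟨I, hI, ⟨e⟩⟩ := h.exists_ofInjective_iso K hK
  exact ⟨L.mapDerivedCategory.mapIso
    (DerivedCategory.Plus.ι.mapIso (G.rightDerivedFunctorPlus.mapIso e.symm) ≪≫
      rightDerivedOfInjectiveIso G I) ≪≫ L.mapDerivedCategoryFactors.app _ ≪≫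
      asIso (DerivedCategory.Q.map (adj.counitCochain _)) ≪≫
      ((DerivedCategory.quotientCompQhIso A).app _).symm ≪≫ DerivedCategory.Plus.ι.mapIso e⟩

/-- Exactness of `L` turns L RG K ≅ K into a comparison of cohomology, by which bounds and
finiteness are transferred. -/
lemma nonempty_homology_iso (h : adj.IsCounitResolving W) (K : DerivedCategory.Plus A)
    (hK : ∀ n, W ((DerivedCategory.homologyFunctor A n).obj K.obj)) (n : ℤ) :
    Nonempty (L.obj ((DerivedCategory.homologyFunctor B n).obj
        (G.rightDerivedFunctorPlus.obj K).obj) ≅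
      (DerivedCategory.homologyFunctor A n).obj K.obj) := by
  obtain ⟨e⟩ := h.nonempty_mapDerivedCategory_iso K hK
  exact ⟨(L.homologyMapDerivedCategoryIso _ n).symm ≪≫
    (DerivedCategory.homologyFunctor A n).mapIso e⟩

/-- The preimage is an injective resolution of the complex obtained by applying `L` to a bounded
below model of `V`; its cohomology is `L` of that of `V`, so the counit is invertible there. -/
lemma exists_rightDerived_iso (h : adj.IsCounitResolving W) [L.ReflectsIsomorphisms]
    (hL : ∀ V, W (L.obj V)) (V : DerivedCategory.Plus B) :
    ∃ K : DerivedCategory.Plus A, (∀ n, W ((DerivedCategory.homologyFunctor A n).obj K.obj)) ∧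
      Nonempty (G.rightDerivedFunctorPlus.obj K ≅ V) := by
  obtain ⟨n, hn⟩ := V.property
  obtain ⟨V', _, ⟨e⟩⟩ := DerivedCategory.exists_iso_Q_obj_of_isGE V.obj n
  have hLV : CochainComplex.IsStrictlyGE ((L.mapHomologicalComplex (.up ℤ)).obj V') n :=
    inferInstance
  obtain ⟨I, hI, i, hi⟩ := CochainComplex.Plus.exists_quasiIso_injective
    ⟨(L.mapHomologicalComplex (.up ℤ)).obj V', n, hLV⟩ n
  let I' : CochainComplex A ℤ := ((InjectiveObject.ι A).mapHomologicalComplex (.up ℤ)).obj I.obj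
  let j : (L.mapHomologicalComplex (.up ℤ)).obj V' ⟶ I' := i.hom
  have hj : QuasiIso j := hi
  have hW (m : ℤ) : W (I'.homology m) :=
    W.prop_of_iso (((V'.sc m).mapHomologyIso L).symm ≪≫ isoOfQuasiIsoAt j m)
      (hL _)
  have hε : QuasiIso (adj.counitCochain I') :=
    h _ ⟨n, inferInstance⟩ (fun i ↦ (I.obj.X i).property) hW
  have := adj.quasiIso_homEquiv_of_quasiIso_counitCochain j hε
  exact ⟨DerivedCategory.Plus.ofInjective I,
    fun m ↦ W.prop_of_iso (DerivedCategory.Plus.homologyOfInjectiveIso I m).symm (hW m),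
    ⟨DerivedCategory.Plus.ι.preimageIso (rightDerivedOfInjectiveIso G I ≪≫
      (asIso (DerivedCategory.Q.map (adj.unitCochain V' ≫
        (G.mapHomologicalComplex (.up ℤ)).map j))).symm ≪≫ e.symm)⟩⟩

end IsCounitResolving

end CategoryTheory.Adjunction

end

/-! ### Functors that are fully faithful on the morphisms from an object -/

section

open Pretriangulated

variable {C D : Type*} [Category* C] [Category* D] [HasShift C ℤ] [HasShift D ℤ]
  (F : C ⥤ D) [F.CommShift ℤ]

namespace CategoryTheory.Functor

/-- The objects `X` such that `F` is bijective on all the types of morphisms `X ⟶ Y`. -/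
def fullyFaithfulFrom : ObjectProperty C :=
  fun X ↦ ∀ Y, Function.Bijective (F.map : (X ⟶ Y) → _)

instance : F.fullyFaithfulFrom.IsClosedUnderIsomorphisms where
  of_iso e h Y := F.map_bijective_of_iso e (Iso.refl Y) (h Y)

lemma fullyFaithfulFrom_shift {X : C} (h : F.fullyFaithfulFrom X) (a : ℤ) :
    F.fullyFaithfulFrom (X⟦a⟧) := by
  intro Y
  refine F.map_bijective_of_iso (Iso.refl _) ((shiftEquiv C a).counitIso.app Y) ?_
  have h₁ : Function.Bijective
      ((shiftFunctor C a ⋙ F).map : (X ⟶ (shiftFunctor C (-a)).obj Y) → _) :=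
    NatTrans.map_bijective_of_isIso (F.commShiftIso a).inv
      (((FullyFaithful.ofFullyFaithful (shiftFunctor D a)).map_bijective _ _).comp (h _))
  exact (Function.Bijective.of_comp_iff _
    ((FullyFaithful.ofFullyFaithful (shiftFunctor C a)).map_bijective _ _)).1 h₁

variable [HasZeroObject C] [HasZeroObject D] [Preadditive C] [Preadditive D]
  [∀ n : ℤ, (shiftFunctor C n).Additive] [∀ n : ℤ, (shiftFunctor D n).Additive]
  [Pretriangulated C] [Pretriangulated D] [F.IsTriangulated]

/-- The five lemma for Hom(-, Y) on the triangle, whose outer terms are shifts of the first and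
third objects. -/
lemma fullyFaithfulFrom_obj₂ {T : Triangle C} (hT : T ∈ distTriang C)
    (h₁ : F.fullyFaithfulFrom T.obj₁) (h₃ : F.fullyFaithfulFrom T.obj₃) :
    F.fullyFaithfulFrom T.obj₂ := by
  intro Y
  have hT' := F.map_distinguished T hT
  constructor
  · rw [show (F.map : (T.obj₂ ⟶ Y) → _) = F.mapAddHom from rfl, injective_iff_map_eq_zero]
    intro f (hf : F.map f = 0)
    obtain ⟨g, rfl⟩ := Triangle.yoneda_exact₂ T hT f ((h₁ Y).injective (by
      rw [F.map_comp, hf, comp_zero, F.map_zero]))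
    obtain ⟨k, hk⟩ : ∃ k : F.obj T.obj₁⟦(1 : ℤ)⟧ ⟶ F.obj Y,
        F.map g = (F.map T.mor₃ ≫ (F.commShiftIso (1 : ℤ)).hom.app T.obj₁) ≫ k :=
      Triangle.yoneda_exact₃ _ hT' (F.map g) ((F.map_comp _ _).symm.trans hf)
    obtain ⟨l, hl⟩ := (F.fullyFaithfulFrom_shift h₁ 1 Y).surjective
      ((F.commShiftIso (1 : ℤ)).hom.app T.obj₁ ≫ k)
    obtain rfl : g = T.mor₃ ≫ l := (h₃ Y).injective (by
      rw [F.map_comp, hl, hk, Category.assoc])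
    rw [comp_distTriang_mor_zero₂₃_assoc _ hT, zero_comp]
  · intro f
    obtain ⟨g, hg⟩ := (h₁ Y).surjective (F.map T.mor₁ ≫ f)
    obtain ⟨f₁, hf₁⟩ : ∃ f₁ : T.obj₂ ⟶ Y, g = T.mor₁ ≫ f₁ := by
      -- The composite `r ≫ g` is the obstruction to extending `g` over the second object; it
      -- vanishes after `F`, hence already in `C`.
      let r : T.obj₃⟦(-1 : ℤ)⟧ ⟶ T.obj₁ := T.invRotate.mor₁
      have hr : r ≫ T.mor₁ = 0 := comp_distTriang_mor_zero₁₂ _ (inv_rot_of_distTriang _ hT)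
      have hrg : r ≫ g = 0 := (F.fullyFaithfulFrom_shift h₃ (-1) Y).injective (by
        rw [F.map_comp, hg, ← F.map_comp_assoc, hr, F.map_zero, zero_comp, F.map_zero])
      exact Triangle.yoneda_exact₂ _ (inv_rot_of_distTriang _ hT) g hrg
    obtain ⟨k, hk⟩ : ∃ k : F.obj T.obj₃ ⟶ F.obj Y, f - F.map f₁ = F.map T.mor₂ ≫ k :=
      Triangle.yoneda_exact₂ _ hT' (f - F.map f₁) (by
        change F.map T.mor₁ ≫ _ = 0
        rw [Preadditive.comp_sub, ← F.map_comp, ← hf₁, hg, sub_self])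
    obtain ⟨l, rfl⟩ := (h₃ Y).surjective k
    exact ⟨f₁ + T.mor₂ ≫ l, by rw [F.map_add, F.map_comp, ← hk, add_sub_cancel]⟩

/-- The objects of the form `F.obj X`, where `F` is bijective on the morphisms from `X`. -/
def fullyFaithfulImage : ObjectProperty D :=
  fun Y ↦ ∃ X, F.fullyFaithfulFrom X ∧ Nonempty (F.obj X ≅ Y)

instance : F.fullyFaithfulImage.IsClosedUnderIsomorphisms where
  of_iso := by
    rintro Y Y' e ⟨X, hX, ⟨e'⟩⟩
    exact ⟨X, hX, ⟨e' ≪≫ e⟩⟩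

/-- By fullness the connecting morphism comes from `C`; completing it there to a triangle yields the
preimage of the middle object. -/
lemma fullyFaithfulImage_obj₂ {T : Triangle D} (hT : T ∈ distTriang D)
    (h₁ : F.fullyFaithfulImage T.obj₁) (h₃ : F.fullyFaithfulImage T.obj₃) :
    F.fullyFaithfulImage T.obj₂ := by
  obtain ⟨X₁, hX₁, ⟨e₁⟩⟩ := h₁
  obtain ⟨X₃, hX₃, ⟨e₃⟩⟩ := h₃
  obtain ⟨g, hg⟩ := (hX₃ (X₁⟦(1 : ℤ)⟧)).surjective
    (e₃.hom ≫ T.mor₃ ≫ e₁.inv⟦1⟧' ≫ (F.commShiftIso (1 : ℤ)).inv.app X₁)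
  obtain ⟨X₂, a, b, hX⟩ := distinguished_cocone_triangle₂ g
  have hX' := F.map_distinguished _ hX
  have comm : (F.mapTriangle.obj (Triangle.mk a b g)).mor₃ ≫ e₁.hom⟦(1 : ℤ)⟧' =
      e₃.hom ≫ T.mor₃ := by
    change (F.map g ≫ (F.commShiftIso (1 : ℤ)).hom.app X₁) ≫ e₁.hom⟦(1 : ℤ)⟧' = _
    rw [hg]
    simp [← Functor.map_comp]
  obtain ⟨c, hc₁, hc₂⟩ := complete_distinguished_triangle_morphism₂ _ T hX' hT e₁.hom e₃.hom comm
  let φ : F.mapTriangle.obj (Triangle.mk a b g) ⟶ T :=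
    { hom₁ := e₁.hom, hom₂ := c, hom₃ := e₃.hom, comm₁ := hc₁, comm₂ := hc₂, comm₃ := comm }
  have : IsIso c := isIso₂_of_isIso₁₃ φ hX' hT (inferInstanceAs (IsIso e₁.hom))
    (inferInstanceAs (IsIso e₃.hom))
  exact ⟨X₂, F.fullyFaithfulFrom_obj₂ hX hX₁ hX₃, ⟨@asIso _ _ (F.obj X₂) _ c this⟩⟩

end CategoryTheory.Functor

end

/-! ### Dévissage in the bounded derived category -/

namespace DerivedCategory

open Pretriangulated

variable {C : Type*} [Category* C] [Abelian C] [HasDerivedCategory C]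

lemma isIso_homologyMap_mor₁ {T : Triangle (DerivedCategory C)} (hT : T ∈ distTriang _) (n : ℤ)
    (h₀ : IsZero ((homologyFunctor C (n - 1)).obj T.obj₃))
    (h₁ : IsZero ((homologyFunctor C n).obj T.obj₃)) :
    IsIso ((homologyFunctor C n).map T.mor₁) := by
  have : Epi ((homologyFunctor C n).map T.mor₁) :=
    (HomologySequence.epi_homologyMap_mor₁_iff T hT n).2 (h₁.eq_of_tgt _ _)
  have : Mono ((homologyFunctor C n).map T.mor₁) :=
    (HomologySequence.mono_homologyMap_mor₁_iff T hT (n - 1) n).2 (h₀.eq_of_src _ _)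
  exact isIso_of_mono_of_epi _

lemma isIso_homologyMap_mor₂ {T : Triangle (DerivedCategory C)} (hT : T ∈ distTriang _) (n : ℤ)
    (h₀ : IsZero ((homologyFunctor C n).obj T.obj₁))
    (h₁ : IsZero ((homologyFunctor C (n + 1)).obj T.obj₁)) :
    IsIso ((homologyFunctor C n).map T.mor₂) := by
  have : Epi ((homologyFunctor C n).map T.mor₂) :=
    (HomologySequence.epi_homologyMap_mor₂_iff T hT n (n + 1)).2 (h₁.eq_of_tgt _ _)
  have : Mono ((homologyFunctor C n).map T.mor₂) :=
    (HomologySequence.mono_homologyMap_mor₂_iff T hT n).2 (h₀.eq_of_src _ _)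
  exact isIso_of_mono_of_epi _

/-- Dévissage: a property of objects of the derived category that is stable by extensions holds
for all bounded objects with cohomology in `W` if it holds for the objects in `W`, placed in
any degree. -/
lemma prop_of_bounded {P : ObjectProperty (DerivedCategory C)} [P.IsClosedUnderIsomorphisms]
    {W : ObjectProperty C} [W.IsClosedUnderIsomorphisms] (hW : ∀ A, IsZero A → W A)
    (single : ∀ (A : C) (n : ℤ), W A → P ((singleFunctor C n).obj A))
    (ext : ∀ T ∈ distTriang (DerivedCategory C), P T.obj₁ → P T.obj₃ → P T.obj₂)
    (K : DerivedCategory C) (hK : TStructure.t.bounded K)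
    (h : ∀ n, W ((homologyFunctor C n).obj K)) : P K := by
  -- Induction on the number `k` of degrees in [a, a + k - 1] that may carry cohomology; `k = 0`
  -- forces `K` to be zero.
  suffices ∀ (a : ℤ) (k : ℕ) (K : DerivedCategory C) (_ : K.IsGE a) (_ : K.IsLE (a + k - 1))
      (_ : ∀ n, W ((homologyFunctor C n).obj K)), P K by
    obtain ⟨⟨a, ha⟩, ⟨b, hb⟩⟩ := hK
    exact this a (b + 1 - a).toNat K ha (TStructure.t.isLE_of_le K b _) h
  intro a k
  induction k with
  | zero =>
    intro K _ _ _
    have h₀ : IsZero K := TStructure.t.isZero K (a + (0 : ℕ) - 1) a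
    exact P.prop_of_iso (((singleFunctor C 0).map_isZero (isZero_zero C)).iso h₀)
      (single _ _ (hW _ (isZero_zero C)))
  | succ k ih =>
    intro K hK₁ hK₂ h
    -- The truncation triangle splits off the top degree a + k: `X` has one degree fewer and `Y` is
    -- a single object.
    obtain ⟨X, Y, hX, hY, f, g, δ, hT⟩ :=
      TStructure.t.exists_triangle K (a + k - 1) (a + k) (by lia)
    replace hX : X.IsLE (a + k - 1) := ⟨hX⟩
    replace hY : Y.IsGE (a + k) := ⟨hY⟩
    have hXi (i : ℤ) (hi : i < a + k) : W ((homologyFunctor C i).obj X) ∧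
        Nonempty ((homologyFunctor C i).obj X ≅ (homologyFunctor C i).obj K) := by
      have : IsIso ((homologyFunctor C i).map f) := isIso_homologyMap_mor₁ hT i
        (Y.isZero_of_isGE (a + k) _ (by lia)) (Y.isZero_of_isGE (a + k) _ (by lia))
      exact ⟨W.prop_of_iso (asIso ((homologyFunctor C i).map f)).symm (h i),
        ⟨asIso ((homologyFunctor C i).map f)⟩⟩
    have hYi (i : ℤ) (hi : a + k ≤ i) :
        Nonempty ((homologyFunctor C i).obj K ≅ (homologyFunctor C i).obj Y) := by
      have : IsIso ((homologyFunctor C i).map g) := isIso_homologyMap_mor₂ hT i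
        (X.isZero_of_isLE (a + k - 1) _ (by lia)) (X.isZero_of_isLE (a + k - 1) _ (by lia))
      exact ⟨asIso ((homologyFunctor C i).map g)⟩
    refine ext _ hT (ih X ?_ hX fun i ↦ ?_) ?_
    · rw [isGE_iff]
      intro i hi
      exact (K.isZero_of_isGE a i hi).of_iso (hXi i (by lia)).2.some
    · by_cases hi : i < a + k
      · exact (hXi i hi).1
      · exact hW _ (X.isZero_of_isLE (a + k - 1) _ (by lia))
    · have : Y.IsLE (a + k) := by
        rw [isLE_iff]
        intro i hi
        exact (K.isZero_of_isLE (a + (k + 1 : ℕ) - 1) i (by lia)).of_iso (hYi i (by lia)).some.symm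
      obtain ⟨A, ⟨e⟩⟩ := Y.exists_iso_singleFunctor_obj_of_isGE_of_isLE (a + k)
      refine P.prop_of_iso e.symm (single A _ (W.prop_of_iso ((hYi (a + k) le_rfl).some ≪≫
        (homologyFunctor C _).mapIso e ≪≫ (singleFunctorCompHomologyFunctorIso C _).app A) (h _)))

end DerivedCategory

/-! ### Fully faithful exact functors that preserve projectives -/

namespace CategoryTheory.Functor

variable {C D : Type*} [Category* C] [Category* D] [Abelian C] [Abelian D]
  (F : C ⥤ D) [F.Additive] [PreservesFiniteLimits F] [PreservesFiniteColimits F]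
  [HasDerivedCategory C] [HasDerivedCategory D]

lemma bijective_mapDerivedCategory_map_of_isKProjective [F.Full] [F.Faithful]
    (P K : CochainComplex C ℤ) [P.IsKProjective]
    [CochainComplex.IsKProjective ((F.mapHomologicalComplex _).obj P)] :
    Function.Bijective (F.mapDerivedCategory.map :
      (DerivedCategory.Q.obj P ⟶ DerivedCategory.Q.obj K) → _) := by
  refine F.mapDerivedCategory.map_bijective_of_iso ((DerivedCategory.quotientCompQhIso C).app P)
    ((DerivedCategory.quotientCompQhIso C).app K) ?_
  have h₁ : Function.Bijective ((F.mapHomotopyCategory (.up ℤ) ⋙ DerivedCategory.Qh).map :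
      ((HomotopyCategory.quotient _ _).obj P ⟶ (HomotopyCategory.quotient _ _).obj K) → _) :=
    (CochainComplex.IsKProjective.Qh_map_bijective ((F.mapHomologicalComplex _).obj P) _).comp
      ((FullyFaithful.ofFullyFaithful (F.mapHomotopyCategory (.up ℤ))).map_bijective _ _)
  have h₂ := NatTrans.map_bijective_of_isIso F.mapDerivedCategoryFactorsh.inv h₁
  exact (Function.Bijective.of_comp_iff _
    (CochainComplex.IsKProjective.Qh_map_bijective P _)).1 h₂

variable [F.Full] [F.Faithful] [EnoughProjectives C] [F.PreservesProjectiveObjects]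

/-- A projective resolution of `A` stays a bounded above complex of projectives under `F`, so on
both sides morphisms from it are homotopy classes, on which `F` is bijective. -/
lemma fullyFaithfulFrom_mapDerivedCategory_single (A : C) (n : ℤ) :
    F.mapDerivedCategory.fullyFaithfulFrom ((DerivedCategory.singleFunctor C n).obj A) := by
  suffices h : F.mapDerivedCategory.fullyFaithfulFrom
      ((DerivedCategory.singleFunctor C 0).obj A) from
    ObjectProperty.prop_of_iso _ (((DerivedCategory.singleFunctors C).shiftIso (-n) n 0
      (by lia)).app A) (fullyFaithfulFrom_shift _ h (-n))
  intro K
  obtain ⟨P⟩ : Nonempty (ProjectiveResolution A) := HasProjectiveResolution.out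
  have := CochainComplex.isKProjective_of_projective P.cochainComplex 0
  have (i : ℤ) : Projective (((F.mapHomologicalComplex (.up ℤ)).obj P.cochainComplex).X i) :=
    F.projective_obj_of_projective (X := P.cochainComplex.X i) inferInstance
  have : CochainComplex.IsStrictlyLE ((F.mapHomologicalComplex (.up ℤ)).obj P.cochainComplex) 0 :=
    inferInstance
  have := CochainComplex.isKProjective_of_projective
    ((F.mapHomologicalComplex (.up ℤ)).obj P.cochainComplex) 0
  exact F.mapDerivedCategory.map_bijective_of_iso
    (asIso (DerivedCategory.Q.map P.π') ≪≫
      ((DerivedCategory.singleFunctorIsoCompQ C 0).app A).symm)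
    (DerivedCategory.Q.objObjPreimageIso K)
    (F.bijective_mapDerivedCategory_map_of_isKProjective P.cochainComplex _)

lemma fullyFaithfulFrom_mapDerivedCategory_of_bounded (K : DerivedCategory C)
    (hK : DerivedCategory.TStructure.t.bounded K) :
    F.mapDerivedCategory.fullyFaithfulFrom K :=
  DerivedCategory.prop_of_bounded (W := ⊤) (fun _ _ ↦ trivial)
    (fun A n _ ↦ F.fullyFaithfulFrom_mapDerivedCategory_single A n)
    (fun _ hT ↦ fullyFaithfulFrom_obj₂ _ hT) K hK (fun _ ↦ trivial)

instance : (DerivedCategory.Bounded.ι ⋙ F.mapDerivedCategory).Full where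
  map_surjective {K K'} f := by
    obtain ⟨g, rfl⟩ := (F.fullyFaithfulFrom_mapDerivedCategory_of_bounded K.obj K.property
      K'.obj).surjective f
    exact ⟨ObjectProperty.homMk g, rfl⟩

instance : (DerivedCategory.Bounded.ι ⋙ F.mapDerivedCategory).Faithful where
  map_injective {K K' _ _} h := DerivedCategory.Bounded.ι.map_injective
    ((F.fullyFaithfulFrom_mapDerivedCategory_of_bounded K.obj K.property K'.obj).injective h)

/-- The essential image of the bounded derived category under a fully faithful exact functor that
preserves projective objects. -/
lemma essImage_bounded_mapDerivedCategory_iff (K : DerivedCategory D) :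
    (DerivedCategory.Bounded.ι ⋙ F.mapDerivedCategory).essImage K ↔
      DerivedCategory.TStructure.t.bounded K ∧
        ∀ n, F.essImage ((DerivedCategory.homologyFunctor D n).obj K) := by
  have isZero_iff (V : C) : IsZero (F.obj V) ↔ IsZero V :=
    ⟨fun h ↦ (IsZero.iff_id_eq_zero V).2 (F.map_injective (h.eq_of_src _ _)), F.map_isZero⟩
  constructor
  · rintro ⟨V, ⟨e⟩⟩
    let e' (n : ℤ) : F.obj ((DerivedCategory.homologyFunctor C n).obj V.obj) ≅
        (DerivedCategory.homologyFunctor D n).obj K :=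
      (F.homologyMapDerivedCategoryIso _ n).symm ≪≫
        (DerivedCategory.homologyFunctor D n).mapIso e
    obtain ⟨⟨a, ha⟩, ⟨b, hb⟩⟩ := V.property
    refine ⟨⟨⟨a, (DerivedCategory.isGE_iff _ _).2 fun i hi ↦ ?_⟩,
      ⟨b, (DerivedCategory.isLE_iff _ _).2 fun i hi ↦ ?_⟩⟩, fun n ↦ ⟨_, ⟨e' n⟩⟩⟩
    · exact (F.map_isZero (DerivedCategory.isZero_of_isGE _ a i hi)).of_iso (e' i).symm
    · exact (F.map_isZero (DerivedCategory.isZero_of_isLE _ b i hi)).of_iso (e' i).symm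
  · rintro ⟨hK, h⟩
    -- Dévissage gives a preimage `V` with no bound; its boundedness follows afterwards from its
    -- cohomology, since `F` reflects zero objects.
    obtain ⟨V, -, ⟨e⟩⟩ : F.mapDerivedCategory.fullyFaithfulImage K :=
      DerivedCategory.prop_of_bounded (W := F.essImage)
        (fun A hA ↦ ⟨_, ⟨(F.map_isZero (isZero_zero C)).iso hA⟩⟩)
        (fun A n ⟨V, ⟨e⟩⟩ ↦ ⟨_, F.fullyFaithfulFrom_mapDerivedCategory_single V n,
          ⟨(F.mapDerivedCategorySingleFunctor n).app V ≪≫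
            (DerivedCategory.singleFunctor D n).mapIso e⟩⟩)
        (fun _ hT ↦ fullyFaithfulImage_obj₂ _ hT) K hK h
    let e' (n : ℤ) : F.obj ((DerivedCategory.homologyFunctor C n).obj V) ≅
        (DerivedCategory.homologyFunctor D n).obj K :=
      (F.homologyMapDerivedCategoryIso _ n).symm ≪≫
        (DerivedCategory.homologyFunctor D n).mapIso e
    obtain ⟨⟨a, ha⟩, ⟨b, hb⟩⟩ := hK
    refine ⟨⟨V, ⟨a, (DerivedCategory.isGE_iff _ _).2 fun i hi ↦ ?_⟩,
      ⟨b, (DerivedCategory.isLE_iff _ _).2 fun i hi ↦ ?_⟩⟩, ⟨e⟩⟩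
    · exact (isZero_iff _).1 ((DerivedCategory.isZero_of_isGE _ a i hi).of_iso (e' i))
    · exact (isZero_iff _).1 ((DerivedCategory.isZero_of_isLE _ b i hi).of_iso (e' i))

end CategoryTheory.Functor

/-! ### The equivalences -/

/-- Two fully faithful functors with the same essential image have equivalent sources. -/
lemma CategoryTheory.Functor.exists_equivalence_comp_iso {C D E : Type*} [Category* C]
    [Category* D] [Category* E] (F : C ⥤ E) (G : D ⥤ E) [F.Full] [F.Faithful] [G.Full] [G.Faithful]
    (h : F.essImage = G.essImage) : ∃ e : C ≌ D, Nonempty (e.functor ⋙ G ≅ F) := by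
  have hF (X : C) : G.essImage (F.obj X) := h ▸ F.obj_mem_essImage X
  let H : C ⥤ D := Functor.essImage.liftFunctor F G hF
  let i : H ⋙ G ≅ F := Functor.essImage.liftFunctorCompIso F G hF
  have : (H ⋙ G).Full := Full.of_iso i.symm
  have : (H ⋙ G).Faithful := Faithful.of_iso i.symm
  have : H.Full := Full.of_comp_faithful H G
  have : H.Faithful := Faithful.of_comp H G
  have : H.EssSurj :=
    { mem_essImage := fun Y ↦ by
        obtain ⟨X, ⟨e⟩⟩ : F.essImage (G.obj Y) := h ▸ G.obj_mem_essImage Y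
        exact ⟨X, ⟨G.preimageIso (i.app X ≪≫ e)⟩⟩ }
  have : H.IsEquivalence := { }
  exact ⟨H.asEquivalence, ⟨i⟩⟩

open ZeroObject in
lemma CategoryTheory.Functor.isZero_of_isZero_obj {C D : Type*} [Category* C] [Category* D]
    [HasZeroObject C] [HasZeroObject D] [HasZeroMorphisms C] [HasZeroMorphisms D]
    (F : C ⥤ D) [F.PreservesZeroMorphisms] [F.ReflectsIsomorphisms] {X : C}
    (h : IsZero (F.obj X)) : IsZero X := by
  have : IsIso (F.map (0 : X ⟶ 0)) :=
    ⟨0, h.eq_of_src _ _, (F.map_isZero (isZero_zero C)).eq_of_src _ _⟩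
  have := isIso_of_reflects_iso (0 : X ⟶ 0) F
  exact (isZero_zero C).of_iso (asIso (0 : X ⟶ 0))

/-! ### Constructibility and boundedness under RΦ -/

namespace Stratification

open SheafMod QuiverRep

variable {X : TopCat.{u}} {𝒮 : Stratification X} {R : Type u} [CommRing R]

instance : (𝒮.weaklyConstructible (R := R)).IsClosedUnderIsomorphisms where
  of_iso e h S hS :=
    have := h S hS
    Sheaf.isConstant_congr _ ((TopCat.Sheaf.pullback _ _).mapIso e)

instance : (𝒮.constructible (R := R)).IsClosedUnderIsomorphisms where
  of_iso {F _} e h := ⟨ObjectProperty.prop_of_iso _ e h.1, fun x ↦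
    have : Module.Finite R ((stalkAt x).obj F) := h.2 x
    Module.Finite.equiv ((stalkAt x).mapIso e).toLinearEquiv⟩

instance (ρ : Set (Relation R 𝒮.Vertex)) : (finiteStalks ρ).IsClosedUnderIsomorphisms where
  of_iso e h x :=
    have : Module.Finite R ((stalk ρ x).obj _) := h x
    Module.Finite.equiv ((stalk ρ x).mapIso e).toLinearEquiv

lemma constructible_ofRep_obj_iff (V : 𝒮.RepStrata R) :
    𝒮.constructible ((𝒮.ofRep R).obj V) ↔ finiteStalks (𝒮.relations R) V := by
  have e (S : 𝒮.Vertex) (x : X) (hx : x ∈ S.1) :=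
    (asIso ((𝒮.toStalk (R := R) S x hx).app V)).toLinearEquiv
  constructor
  · intro h S
    obtain ⟨x, hx⟩ := 𝒮.exists_mem_vertex S
    have : Module.Finite R ((𝒮.ofRep R ⋙ stalkAt x).obj V) := h.2 x
    exact Module.Finite.equiv (e S x hx).symm
  · refine fun h ↦ ⟨𝒮.weaklyConstructible_ofRep_obj V, fun x ↦ ?_⟩
    obtain ⟨S, hx⟩ := 𝒮.exists_vertex_mem x
    have : Module.Finite R ((𝒮.repStalk S).obj V) := h S
    exact Module.Finite.equiv (e S x hx)

lemma IsAcyclic.isCounitResolving (h𝒮 : 𝒮.IsAcyclic R) :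
    (𝒮.repAdjunction R).IsCounitResolving 𝒮.weaklyConstructible :=
  h𝒮.quasiIso_counitCochain

variable [HasDerivedCategory.{w₁} (Sh R X)] [HasDerivedCategory.{w₂} (𝒮.RepStrata R)]

lemma IsAcyclic.isEquivalence_plus (h𝒮 : 𝒮.IsAcyclic R) :
    ((cohomologyPlus 𝒮.weaklyConstructible).ι ⋙
      (𝒮.toRep R).rightDerivedFunctorPlus).IsEquivalence where
  faithful := ⟨fun {K K' _ _} h ↦ ObjectProperty.hom_ext _
    ((h𝒮.isCounitResolving.bijective_map _ _ K.property K'.property).injective h)⟩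
  full := ⟨fun {K K'} f ↦ by
    obtain ⟨g, rfl⟩ :=
      (h𝒮.isCounitResolving.bijective_map _ _ K.property K'.property).surjective f
    exact ⟨ObjectProperty.homMk g, rfl⟩⟩
  essSurj := ⟨fun V ↦ by
    obtain ⟨K, hK, ⟨e⟩⟩ :=
      h𝒮.isCounitResolving.exists_rightDerived_iso 𝒮.weaklyConstructible_ofRep_obj V
    exact ⟨⟨K, hK⟩, ⟨e⟩⟩⟩

variable (𝒮) in
/-- The right derived functor of `toRep` on the complexes in `Dᵇ(X)` with cohomology in `P`. -/
abbrev rightDerivedBounded (P : ObjectProperty (Sh R X)) :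
    (cohomologyBounded P).FullSubcategory ⥤ DerivedCategory (𝒮.RepStrata R) :=
  (cohomologyBounded P).ι ⋙ boundedToPlus R X ⋙ (𝒮.toRep R).rightDerivedFunctorPlus ⋙
    DerivedCategory.Plus.ι

variable {P : ObjectProperty (Sh R X)}

lemma IsAcyclic.bijective_rightDerivedBounded_map (h𝒮 : 𝒮.IsAcyclic R)
    (hP : P ≤ 𝒮.weaklyConstructible) (K K' : (cohomologyBounded P).FullSubcategory) :
    Function.Bijective ((𝒮.rightDerivedBounded P).map : (K ⟶ K') → _) :=
  (DerivedCategory.TStructure.t.plus.fullyFaithfulι.map_bijective _ _).comp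
    ((h𝒮.isCounitResolving.bijective_map ((boundedToPlus R X).obj K.obj)
      ((boundedToPlus R X).obj K'.obj) (fun n ↦ hP _ (K.property n))
      (fun n ↦ hP _ (K'.property n))).comp
      (((ObjectProperty.fullyFaithfulιOfLE _).map_bijective _ _).comp
        ((cohomologyBounded P).fullyFaithfulι.map_bijective _ _)))

lemma IsAcyclic.full_rightDerivedBounded (h𝒮 : 𝒮.IsAcyclic R)
    (hP : P ≤ 𝒮.weaklyConstructible) : (𝒮.rightDerivedBounded P).Full :=
  ⟨fun f ↦ (h𝒮.bijective_rightDerivedBounded_map hP _ _).surjective f⟩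

lemma IsAcyclic.faithful_rightDerivedBounded (h𝒮 : 𝒮.IsAcyclic R)
    (hP : P ≤ 𝒮.weaklyConstructible) : (𝒮.rightDerivedBounded P).Faithful :=
  ⟨fun h ↦ (h𝒮.bijective_rightDerivedBounded_map hP _ _).injective h⟩

/-- `ofRep` carries the cohomology of the image to that of the source. It preserves and reflects
zero objects, so bounds pass both ways, and `hPQ` translates the condition on cohomology. -/
lemma IsAcyclic.essImage_rightDerivedBounded_iff (h𝒮 : 𝒮.IsAcyclic R)
    [P.IsClosedUnderIsomorphisms] (hP : P ≤ 𝒮.weaklyConstructible)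
    {Q : ObjectProperty (𝒮.RepStrata R)} [Q.IsClosedUnderIsomorphisms]
    (hPQ : ∀ V, P ((𝒮.ofRep R).obj V) ↔ Q V) (Y : DerivedCategory (𝒮.RepStrata R)) :
    (𝒮.rightDerivedBounded P).essImage Y ↔ DerivedCategory.TStructure.t.bounded Y ∧
      ∀ n, Q ((DerivedCategory.homologyFunctor _ n).obj Y) := by
  have key (K : DerivedCategory.Plus (Sh R X))
      (hK : ∀ n, 𝒮.weaklyConstructible ((DerivedCategory.homologyFunctor _ n).obj K.obj))
      (e : ((𝒮.toRep R).rightDerivedFunctorPlus.obj K).obj ≅ Y) (n : ℤ) :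
      Nonempty ((𝒮.ofRep R).obj ((DerivedCategory.homologyFunctor _ n).obj Y) ≅
        (DerivedCategory.homologyFunctor _ n).obj K.obj) := by
    obtain ⟨i⟩ := h𝒮.isCounitResolving.nonempty_homology_iso K hK n
    exact ⟨(𝒮.ofRep R).mapIso ((DerivedCategory.homologyFunctor _ n).mapIso e.symm) ≪≫ i⟩
  constructor
  · rintro ⟨K, ⟨e⟩⟩
    have i := key ((boundedToPlus R X).obj K.obj) (fun n ↦ hP _ (K.property n)) e
    obtain ⟨⟨a, ha⟩, ⟨b, hb⟩⟩ := K.obj.property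
    refine ⟨⟨⟨a, (DerivedCategory.isGE_iff _ _).2 fun n hn ↦ ?_⟩,
      ⟨b, (DerivedCategory.isLE_iff _ _).2 fun n hn ↦ ?_⟩⟩,
      fun n ↦ (hPQ _).1 (P.prop_of_iso (i n).some.symm (K.property n))⟩
    · exact (𝒮.ofRep R).isZero_of_isZero_obj
        ((DerivedCategory.isZero_of_isGE K.obj.obj a n hn).of_iso (i n).some)
    · exact (𝒮.ofRep R).isZero_of_isZero_obj
        ((DerivedCategory.isZero_of_isLE K.obj.obj b n hn).of_iso (i n).some)
  · rintro ⟨⟨ha, ⟨b, hb⟩⟩, hY⟩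
    obtain ⟨K, hK, ⟨e⟩⟩ := h𝒮.isCounitResolving.exists_rightDerived_iso
      𝒮.weaklyConstructible_ofRep_obj ⟨Y, ha⟩
    have i := key K hK (DerivedCategory.Plus.ι.mapIso e)
    exact ⟨⟨⟨K.obj, K.property, b, (DerivedCategory.isLE_iff _ _).2 fun n hn ↦
      ((𝒮.ofRep R).map_isZero (DerivedCategory.isZero_of_isLE _ b n hn)).of_iso (i n).some.symm⟩,
      fun n ↦ P.prop_of_iso (i n).some ((hPQ _).2 (hY n))⟩, ⟨DerivedCategory.Plus.ι.mapIso e⟩⟩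

end Stratification

end

theorem mainTheorem3 {R : Type u} [CommRing R] [IsNoetherianRing R]
    (hR : RingFiniteHomologicalDimension R) (X : TopCat.{u})
    (hX : SheafMod.FiniteHomologicalDimension R X)
    (𝒮 : Stratification X) (h𝒮 : 𝒮.IsAcyclic R)
    [HasDerivedCategory.{w₁} (SheafMod.Sh R X)]
    [HasDerivedCategory.{w₂} (𝒮.RepStrata R)]
    [HasDerivedCategory.{w₃} (𝒮.RepStrataFin R)] :
    ((Stratification.cohomologyPlus 𝒮.weaklyConstructible).ι ⋙
      (𝒮.toRep R).rightDerivedFunctorPlus :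
        𝒮.DPlusWC R ⥤ DerivedCategory.Plus (𝒮.RepStrata R)).IsEquivalence ∧
    (∃ E : 𝒮.DBoundedWC R ≌ DerivedCategory.Bounded (𝒮.RepStrata R),
      Nonempty (E.functor ⋙ DerivedCategory.Bounded.ι ≅
        (Stratification.cohomologyBounded 𝒮.weaklyConstructible).ι ⋙
          Stratification.boundedToPlus R X ⋙
            (𝒮.toRep R).rightDerivedFunctorPlus ⋙ DerivedCategory.Plus.ι)) ∧
    (∃ E : 𝒮.DBoundedC R ≌ DerivedCategory.Bounded (𝒮.RepStrataFin R),
      Nonempty (E.functor ⋙ DerivedCategory.Bounded.ι ⋙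
          (QuiverRep.finiteStalks (𝒮.relations R)).ι.mapDerivedCategory ≅
        (Stratification.cohomologyBounded 𝒮.constructible).ι ⋙
          Stratification.boundedToPlus R X ⋙
            (𝒮.toRep R).rightDerivedFunctorPlus ⋙ DerivedCategory.Plus.ι)) := by
  have hc : 𝒮.constructible (R := R) ≤ 𝒮.weaklyConstructible := fun _ h ↦ h.1
  have := h𝒮.full_rightDerivedBounded le_rfl
  have := h𝒮.faithful_rightDerivedBounded le_rfl
  have := h𝒮.full_rightDerivedBounded hc
  have := h𝒮.faithful_rightDerivedBounded hc
  -- For the bounded statements all functors into D(Rep) involved are fully faithful, so only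
  -- essential images remain to be compared.
  refine ⟨h𝒮.isEquivalence_plus,
    Functor.exists_equivalence_comp_iso (𝒮.rightDerivedBounded 𝒮.weaklyConstructible)
      DerivedCategory.Bounded.ι ?_,
    Functor.exists_equivalence_comp_iso (𝒮.rightDerivedBounded 𝒮.constructible)
      (DerivedCategory.Bounded.ι ⋙
        (QuiverRep.finiteStalks (𝒮.relations R)).ι.mapDerivedCategory) ?_⟩
  · ext Y
    rw [h𝒮.essImage_rightDerivedBounded_iff le_rfl (Q := ⊤)
      (fun V ↦ ⟨fun _ ↦ trivial, fun _ ↦ 𝒮.weaklyConstructible_ofRep_obj V⟩)]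
    exact ⟨fun h ↦ ⟨⟨Y, h.1⟩, ⟨Iso.refl _⟩⟩,
      fun ⟨Y', ⟨e⟩⟩ ↦ ⟨ObjectProperty.prop_of_iso _ e Y'.property, fun _ ↦ trivial⟩⟩
  · ext Y
    rw [h𝒮.essImage_rightDerivedBounded_iff hc 𝒮.constructible_ofRep_obj_iff,
      Functor.essImage_bounded_mapDerivedCategory_iff]
    refine and_congr_right' (forall_congr' fun n ↦ ?_)
    exact ⟨fun h ↦ ⟨⟨_, h⟩, ⟨Iso.refl _⟩⟩,
      fun ⟨V, ⟨e⟩⟩ ↦ ObjectProperty.prop_of_iso _ e V.property⟩
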